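/- Let $D\subset\mathbb{R}^2$ be a bounded domain (a nonempty, bounded, connected open set) with $C^2$-smooth boundary $\partial D$, meaning that near each boundary point, in suitable orthonormal coordinates, $D$ is the region strictly above the graph of a $C^2$ function of one variable. Let $\nu_x$ be the outward unit normal at $x\in\partial D$ and $ds$ the arc length on $\partial D$. For complex-valued $\varphi\in L^2(\partial D)$ let $$S_{\partial D}[\varphi](x)=\frac1{2\pi}\int_{\partial D}\ln|x-y|\,\varphi(y)\,ds(y),\qquad x\in\mathbb{R}^2,$$ be its single-layer potential and $$K^*_{\partial D}[\varphi](x)=\frac1{2\pi}\int_{\partial D}\frac{\langle x-y,\nu_x\rangle}{|x-y|^2}\,\varphi(y)\,ds(y),\qquad x\in\partial D,$$ the Neumann--Poincar\'e operator. Suppose that $1/2$ is an eigenvalue of $K^*_{\partial D}$ and that $\psi_0\in L^2(\partial D)$ is a corresponding eigenfunction, that is, $\psi_0\neq 0$ and $K^*_{\partial D}[\psi_0]=\tfrac12\psi_0$ in $L^2(\partial D)$. Then there is a constant $C\in\mathbb{C}$ such that $S_{\partial D}[\psi_0](x)=C$ for all $x\in D$. -/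

import Mathlib

open Set Filter Topology MeasureTheory
open scoped RealInnerProductSpace

noncomputable section

/-- The Euclidean plane `ℝ²`. -/
abbrev Plane : Type := EuclideanSpace ℝ (Fin 2)

/-- `D` has a `C²`-smooth boundary: near each boundary point, in suitable orthonormal coordinates,
`D` is the region strictly above the graph of a `C²` function of one variable. -/
def HasC2Boundary (D : Set Plane) : Prop :=
  ∀ p ∈ frontier D, ∃ (e : Plane ≃ₗᵢ[ℝ] Plane) (γ : ℝ → ℝ) (r : ℝ),
    ContDiff ℝ 2 γ ∧ 0 < r ∧ ∀ x ∈ Metric.ball p r, x ∈ D ↔ γ (e x 0) < e x 1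

/-- A bounded domain (nonempty connected open set) of the plane with `C²`-smooth boundary. -/
structure IsBoundedC2Domain (D : Set Plane) : Prop where
  isOpen : IsOpen D
  isConnected : IsConnected D
  isBounded : Bornology.IsBounded D
  boundary : HasC2Boundary D

/-- `n` is the outward unit normal vector to `∂D` at `p`: it has length one, each ray from `p`
making an obtuse angle with `n` starts inside `D`, and each ray making an acute angle with `n`
starts outside the closure of `D`. -/
def IsOutwardUnitNormal (D : Set Plane) (p n : Plane) : Prop :=
  ‖n‖ = 1 ∧
    (∀ v : Plane, ⟪n, v⟫ < 0 → ∀ᶠ t : ℝ in 𝓝[>] 0, p + t • v ∈ D) ∧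
    (∀ v : Plane, 0 < ⟪n, v⟫ → ∀ᶠ t : ℝ in 𝓝[>] 0, p + t • v ∉ closure D)

theorem IsOutwardUnitNormal.unique {D : Set Plane} {p n m : Plane}
    (hn : IsOutwardUnitNormal D p n) (hm : IsOutwardUnitNormal D p m) : n = m := by
  by_contra hne
  have hlt : ⟪n, m⟫ < 1 := (inner_lt_one_iff_real_of_norm_eq_one hn.1 hm.1).2 hne
  have h1 : ⟪n, m - n⟫ < 0 := by
    rw [inner_sub_right, real_inner_self_eq_norm_sq, hn.1]; linarith
  have h2 : 0 < ⟪m, m - n⟫ := by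
    rw [inner_sub_right, real_inner_self_eq_norm_sq, hm.1, real_inner_comm]; linarith
  obtain ⟨t, ht1, ht2⟩ := ((hn.2.1 _ h1).and (hm.2.2 _ h2)).exists
  exact ht2 (subset_closure ht1)

theorem HasC2Boundary.exists_isOutwardUnitNormal {D : Set Plane} (hD : HasC2Boundary D)
    (ho : IsOpen D) {p : Plane} (hp : p ∈ frontier D) : ∃ n, IsOutwardUnitNormal D p n := by
  obtain ⟨e, γ, r, hγ, hr, hx⟩ := hD p hp
  have hγc : Continuous γ := hγ.continuous
  have hpD : p ∉ D := fun h => (ho.frontier_eq ▸ hp).2 h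
  -- points below the graph have a neighbourhood disjoint from `D`
  have key : ∀ x ∈ Metric.ball p r, e x 1 < γ (e x 0) → x ∉ closure D := by
    intro x hxb hlt hcl
    have hopen : IsOpen {y : Plane | y ∈ Metric.ball p r ∧ e y 1 < γ (e y 0)} := by
      apply Metric.isOpen_ball.inter
      have hc0 : Continuous fun y : Plane => e y 0 := by fun_prop
      have hc1 : Continuous fun y : Plane => e y 1 := by fun_prop
      exact isOpen_lt hc1 (hγc.comp hc0)
    obtain ⟨y, hy, hyD⟩ := mem_closure_iff.1 hcl _ hopen ⟨hxb, hlt⟩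
    have := (hx y hy.1).1 hyD
    linarith [hy.2]
  have hpb : p ∈ Metric.ball p r := Metric.mem_ball_self hr
  have hval : γ (e p 0) = e p 1 := by
    apply le_antisymm
    · by_contra h
      exact key p hpb (not_le.1 h) hp.1
    · by_contra h
      exact hpD ((hx p hpb).2 (not_le.1 h))
  set c := deriv γ (e p 0) with hc
  have hpos : (0 : ℝ) < √(1 + c ^ 2) := by positivity
  refine ⟨(√(1 + c ^ 2))⁻¹ • e.symm !₂[c, -1], ?_, ?_⟩
  · rw [norm_smul, LinearIsometryEquiv.norm_map, EuclideanSpace.norm_eq]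
    simp only [Fin.sum_univ_two, Real.norm_eq_abs, sq_abs]
    simp only [abs_of_pos (inv_pos.2 hpos), Matrix.cons_val_zero,
      Matrix.cons_val_one]
    rw [show c ^ 2 + (-1) ^ 2 = 1 + c ^ 2 by ring]
    exact inv_mul_cancel₀ hpos.ne'
  have hin : ∀ v : Plane, ⟪(√(1 + c ^ 2))⁻¹ • e.symm !₂[c, -1], v⟫
      = (√(1 + c ^ 2))⁻¹ * (c * e v 0 - e v 1) := by
    intro v
    rw [real_inner_smul_left, ← LinearIsometryEquiv.inner_map_map e (e.symm _) v,
      LinearIsometryEquiv.apply_symm_apply]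
    congr 1
    simp [PiLp.inner_apply, Fin.sum_univ_two]
    ring
  have hball : ∀ v : Plane, ∀ᶠ t : ℝ in 𝓝[>] 0, p + t • v ∈ Metric.ball p r := by
    intro v
    have hcont : ContinuousAt (fun t : ℝ => p + t • v) 0 := by fun_prop
    have : ∀ᶠ t : ℝ in 𝓝 0, p + t • v ∈ Metric.ball p r :=
      hcont (by simpa using Metric.ball_mem_nhds p hr)
    exact this.filter_mono nhdsWithin_le_nhds
  have hder : ∀ v : Plane, HasDerivAt
      (fun t : ℝ => e (p + t • v) 1 - γ (e (p + t • v) 0)) (e v 1 - c * e v 0) 0 := by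
    intro v
    have h0 : ∀ i, HasDerivAt (fun t : ℝ => e (p + t • v) i) (e v i) 0 := by
      intro i
      simpa using ((hasDerivAt_id (0 : ℝ)).mul_const (e v i)).const_add (e p i)
    have hg : HasDerivAt γ c (e (p + (0 : ℝ) • v) 0) := by
      rw [zero_smul, add_zero]
      exact (hγ.differentiable (by norm_num) (e p 0)).hasDerivAt
    exact (h0 1).sub (hg.comp (0 : ℝ) (h0 0))
  have hsl : ∀ v : Plane, Tendsto (fun t : ℝ => t⁻¹ *
      (e (p + t • v) 1 - γ (e (p + t • v) 0))) (𝓝[>] 0) (𝓝 (e v 1 - c * e v 0)) := by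
    intro v
    have := (hasDerivAt_iff_tendsto_slope_zero.1 (hder v)).mono_left
      (nhdsWithin_mono 0 (fun t (ht : 0 < t) => ht.ne') : 𝓝[>] (0 : ℝ) ≤ 𝓝[≠] 0)
    simpa [hval] using this
  refine ⟨fun v hv => ?_, fun v hv => ?_⟩
  · rw [hin] at hv
    have hv' : 0 < e v 1 - c * e v 0 := by
      have := neg_of_mul_neg_right hv (inv_pos.2 hpos).le
      linarith
    filter_upwards [hball v, (hsl v).eventually (lt_mem_nhds hv'), self_mem_nhdsWithin]
      with t h1 h2 h3
    have h4 := (pos_iff_pos_of_mul_pos h2).1 (inv_pos.2 h3)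
    exact (hx _ h1).2 (by linarith)
  · rw [hin] at hv
    have hv' : e v 1 - c * e v 0 < 0 := by
      have := (pos_iff_pos_of_mul_pos hv).1 (inv_pos.2 hpos)
      linarith
    filter_upwards [hball v, (hsl v).eventually (gt_mem_nhds hv'), self_mem_nhdsWithin]
      with t h1 h2 h3
    have h4 := neg_of_mul_neg_right h2 (inv_pos.2 h3).le
    exact key _ h1 (by linarith)

open Classical in
/-- The outward unit normal vector `ν_p` to `∂D` at `p`. It exists and is unique at each boundary
point of an open set with `C²` boundary; where there is none the value is `0`. -/
def outwardNormal (D : Set Plane) (p : Plane) : Plane :=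
  if h : ∃ n, IsOutwardUnitNormal D p n then h.choose else 0

/-- The arc length measure `ds` on `∂D`: one-dimensional Hausdorff measure restricted to `∂D`. -/
def arcLength (D : Set Plane) : Measure Plane :=
  (Measure.hausdorffMeasure 1).restrict (frontier D)

/-- The fundamental solution `G(x) = (1/2π) ln |x|` of the Laplace operator in the plane. -/
def fundamentalSolution (x : Plane) : ℝ :=
  1 / (2 * Real.pi) * Real.log ‖x‖

/-- The single-layer potential `S_{∂D}[φ](x) = ∫_{∂D} G(x - y) φ(y) ds(y)`. -/
def singleLayer (D : Set Plane) (φ : Plane → ℂ) (x : Plane) : ℂ :=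
  ∫ y, (fundamentalSolution (x - y) : ℂ) * φ y ∂(arcLength D)

/-- The Neumann–Poincaré operator
`K*_{∂D}[φ](x) = (1/2π) ∫_{∂D} ⟨x - y, ν_x⟩ / |x - y|² φ(y) ds(y)`, for `x ∈ ∂D`. -/
def neumannPoincare (D : Set Plane) (φ : Plane → ℂ) (x : Plane) : ℂ :=
  1 / (2 * (Real.pi : ℂ)) *
    ∫ y, ((⟪x - y, outwardNormal D x⟫ / ‖x - y‖ ^ 2 : ℝ) : ℂ) * φ y ∂(arcLength D)

/-- `ψ` represents an eigenfunction in `L²(∂D)` of `K*_{∂D}` with eigenvalue `lam`: it is square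
integrable, not the zero element of `L²(∂D)`, and `K*_{∂D}[ψ] = lam ψ` in `L²(∂D)`. -/
def IsNPEigenfunction (D : Set Plane) (lam : ℂ) (ψ : Plane → ℂ) : Prop :=
  MemLp ψ 2 (arcLength D) ∧ ¬ (ψ =ᵐ[arcLength D] 0) ∧
    neumannPoincare D ψ =ᵐ[arcLength D] fun x => lam * ψ x

end

/-! Write `u` for the single-layer potential of a real density `f` in L². Formally, the interior
normal derivative of `u` is `(-1/2 + K*) f`, which vanishes when `K* f = f/2`. Green's identity then
gives `∫_D |∇u|² = 0`, so `u` is constant on the connected set `D`. Complex densities are split into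
real and imaginary parts, as all kernels are real.

To avoid traces and jump relations for L² densities, the logarithm is replaced by `log(|x|² +
ε²)/(4π)`. Its Laplacian `δ_ε` is a smooth approximate identity of mass one, and the regularized
potential `u_ε` is C¹ with C¹ gradient on the whole plane. Gauss–Green gives `∫_D |∇u_ε|² + ∫_D u_ε
Δu_ε = ∫_{∂D} u_ε ∂_ν u_ε` (`regularized_green_identity`).

As `ε → 0`, `u_ε → u` uniformly (`exists_abs_layer_logKernel_sub_le`). The normal kernels stay
bounded because the boundary is C² (`exists_abs_normalKernel_le`), so the right side tends to `∫ u
K* f = ½ ∫ u f`. Half of the mass of `δ_ε` centred at a boundary point lies asymptotically in `D`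
(`tendsto_setIntegral_mul_deltaKernel`), so the second term on the left also tends to `½ ∫ u f`.
Hence `∫_D |∇u_ε|² → 0`, and Fatou's lemma with continuity gives `∇u = 0` throughout `D`.

Hausdorff measure on the boundary is computed in graph charts, and Gauss–Green is proved by
flattening these charts and localizing with bump functions. -/

/-! ### Arc length of a graph as a Hausdorff measure. -/

/-- A measure on the line whose value on each interval lies between the extreme values of a
continuous density times the length is the measure with that density. -/
theorem measure_eq_withDensity_of_mean_value {ν : Measure ℝ} {w : ℝ → ℝ} (hw : Continuous w)
    (h0 : ∀ t, 0 ≤ w t)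
    (h : ∀ a b, a < b → ∃ ξ ∈ Icc a b, ∃ η ∈ Icc a b,
      ENNReal.ofReal (w ξ * (b - a)) ≤ ν (Ioc a b) ∧
      ν (Ioc a b) ≤ ENNReal.ofReal (w η * (b - a))) :
    ν = volume.withDensity fun t => ENNReal.ofReal (w t) := by
  have hfin : ∀ a b, ν (Ioc a b) ≠ ⊤ := by
    intro a b
    rcases lt_or_ge a b with hab | hab
    · obtain ⟨ξ, -, η, -, -, h2⟩ := h a b hab
      exact ne_top_of_le_ne_top ENNReal.ofReal_ne_top h2
    · simp [Ioc_eq_empty (not_lt.2 hab)]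
  have hreal : ∀ a b, a < b → ∃ ξ ∈ Icc a b, ∃ η ∈ Icc a b,
      w ξ * (b - a) ≤ ν.real (Ioc a b) ∧ ν.real (Ioc a b) ≤ w η * (b - a) := by
    intro a b hab
    obtain ⟨ξ, hξ, η, hη, h1, h2⟩ := h a b hab
    refine ⟨ξ, hξ, η, hη, ?_, ?_⟩
    · exact (ENNReal.ofReal_le_iff_le_toReal (hfin a b)).1 h1
    · exact ENNReal.toReal_le_of_le_ofReal (mul_nonneg (h0 _) (sub_nonneg.2 hab.le)) h2
  have hloc : IsLocallyFiniteMeasure ν := by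
    refine ⟨fun x => ⟨Ioo (x - 1) (x + 1), Ioo_mem_nhds (by linarith) (by linarith), ?_⟩⟩
    exact lt_of_le_of_lt (measure_mono Ioo_subset_Ioc_self) (hfin _ _).lt_top
  refine Measure.ext_of_Ioc _ _ fun a b hab => ?_
  have hadd : ∀ x y, a ≤ x → x ≤ y →
      ν.real (Ioc a y) - ν.real (Ioc a x) = ν.real (Ioc x y) := by
    intro x y hx hy
    rw [← Ioc_union_Ioc_eq_Ioc hx hy, measureReal_union _ measurableSet_Ioc (hfin _ _) (hfin _ _)]
    · ring
    · exact Ioc_disjoint_Ioc_of_le le_rfl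
  obtain ⟨M, hM⟩ := (isCompact_Icc (a := a) (b := b)).bddAbove_image hw.continuousOn
  have hM' : ∀ t ∈ Icc a b, w t ≤ M := fun t ht => hM (mem_image_of_mem w ht)
  have hbd : ∀ x ∈ Icc a b, ∀ y ∈ Icc a b, x ≤ y →
      |ν.real (Ioc a y) - ν.real (Ioc a x)| ≤ M * |y - x| := by
    intro x hx y hy hxy
    rw [hadd x y hx.1 hxy, abs_of_nonneg measureReal_nonneg, abs_of_nonneg (sub_nonneg.2 hxy)]
    rcases hxy.eq_or_lt with rfl | hlt
    · simp
    obtain ⟨ξ, -, η, hη, -, h2⟩ := hreal x y hlt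
    exact h2.trans (mul_le_mul_of_nonneg_right (hM' η ⟨hx.1.trans hη.1, hη.2.trans hy.2⟩)
      (sub_nonneg.2 hxy))
  have hcont : ContinuousOn (fun x => ν.real (Ioc a x)) (Icc a b) := by
    have hMn : 0 ≤ M := (h0 a).trans (hM' a ⟨le_rfl, hab.le⟩)
    have : LipschitzOnWith M.toNNReal (fun x => ν.real (Ioc a x)) (Icc a b) := by
      refine LipschitzOnWith.of_dist_le_mul fun x hx y hy => ?_
      rw [Real.coe_toNNReal _ hMn, Real.dist_eq, Real.dist_eq]
      rcases le_total x y with hxy | hxy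
      · rw [abs_sub_comm, abs_sub_comm x]; exact hbd x hx y hy hxy
      · exact hbd y hy x hx hxy
    exact this.continuousOn
  -- The bounds on `(x, y]` squeeze the difference quotient between two values of `w` near `x`. With
  -- continuity, this right derivative is enough for the fundamental theorem of calculus.
  have hder : ∀ x ∈ Ioo a b, HasDerivWithinAt (fun x => ν.real (Ioc a x)) (w x) (Ioi x) x := by
    intro x hx
    rw [hasDerivWithinAt_iff_tendsto_slope' (by simp)]
    rw [Metric.tendsto_nhds]
    intro ε hε
    obtain ⟨δ, hδ, hδw⟩ := Metric.continuousAt_iff.1 (hw.continuousAt (x := x)) ε hε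
    have : Ioo x (x + δ) ∈ 𝓝[>] x := Ioo_mem_nhdsGT (by linarith)
    filter_upwards [this] with y hy
    have hyx : 0 < y - x := sub_pos.2 hy.1
    obtain ⟨ξ, hξ, η, hη, h1, h2⟩ := hreal x y hy.1
    rw [slope_def_field, hadd x y hx.1.le hy.1.le]
    have hξ' := hδw (x := ξ) (by rw [Real.dist_eq, abs_lt]; constructor <;> linarith [hξ.1, hξ.2, hy.2])
    have hη' := hδw (x := η) (by rw [Real.dist_eq, abs_lt]; constructor <;> linarith [hη.1, hη.2, hy.2])
    rw [Real.dist_eq, abs_lt] at hξ' hη' ⊢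
    have h1' := (le_div_iff₀ hyx).2 h1
    have h2' := (div_le_iff₀ hyx).2 h2
    constructor <;> linarith [hξ'.1, hη'.2]
  have key := intervalIntegral.integral_eq_sub_of_hasDeriv_right (hcont.mono (by simp [uIcc_of_le hab.le]))
    (by simpa [hab.le] using hder) (hw.intervalIntegrable a b)
  rw [withDensity_apply _ measurableSet_Ioc,
    ← ofReal_integral_eq_lintegral_ofReal
      ((hw.integrableOn_Icc (a := a) (b := b)).mono_set Ioc_subset_Icc_self)
      (Eventually.of_forall h0), ← intervalIntegral.integral_of_le hab.le, key]
  simp [ENNReal.ofReal_toReal (hfin a b), measureReal_def]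

/-- The graph of `γ` in the orthonormal coordinates `e`, shifted vertically by `t`. -/
noncomputable def graphMap (e : Plane ≃ₗᵢ[ℝ] Plane) (γ : ℝ → ℝ) (s t : ℝ) : Plane :=
  e.symm !₂[s, γ s + t]

@[simp] theorem graphMap_zero_coord (e : Plane ≃ₗᵢ[ℝ] Plane) (γ : ℝ → ℝ) (s t : ℝ) :
    e (graphMap e γ s t) 0 = s := by simp [graphMap]

@[simp] theorem graphMap_one_coord (e : Plane ≃ₗᵢ[ℝ] Plane) (γ : ℝ → ℝ) (s t : ℝ) :
    e (graphMap e γ s t) 1 = γ s + t := by simp [graphMap]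

theorem graphMap_coords (e : Plane ≃ₗᵢ[ℝ] Plane) (γ : ℝ → ℝ) (x : Plane) :
    graphMap e γ (e x 0) (e x 1 - γ (e x 0)) = x := by
  apply e.injective
  ext i
  fin_cases i <;> simp

/-- Arc length density of a graph. -/
noncomputable def graphSpeed (γ : ℝ → ℝ) (s : ℝ) : ℝ := √(1 + deriv γ s ^ 2)

theorem one_le_graphSpeed (γ : ℝ → ℝ) (s : ℝ) : 1 ≤ graphSpeed γ s := by
  rw [graphSpeed, Real.one_le_sqrt]; nlinarith [sq_nonneg (deriv γ s)]

theorem graphSpeed_pos (γ : ℝ → ℝ) (s : ℝ) : 0 < graphSpeed γ s :=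
  one_pos.trans_le (one_le_graphSpeed γ s)

theorem continuous_graphSpeed {γ : ℝ → ℝ} (hγ : ContDiff ℝ 1 γ) : Continuous (graphSpeed γ) := by
  have := hγ.continuous_deriv le_rfl
  unfold graphSpeed
  fun_prop

theorem continuous_graphMap (e : Plane ≃ₗᵢ[ℝ] Plane) {γ : ℝ → ℝ} (hγ : Continuous γ) :
    Continuous fun z : ℝ × ℝ => graphMap e γ z.1 z.2 := by
  unfold graphMap
  fun_prop

theorem isClosedEmbedding_graphMap (e : Plane ≃ₗᵢ[ℝ] Plane) {γ : ℝ → ℝ} (hγ : Continuous γ) :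
    IsClosedEmbedding fun s => graphMap e γ s 0 := by
  have h1 : Continuous fun s => graphMap e γ s 0 :=
    (continuous_graphMap e hγ).comp (by fun_prop : Continuous fun s : ℝ => (s, (0 : ℝ)))
  have hl : Function.LeftInverse (fun x => e x 0) (fun s => graphMap e γ s 0) := fun s => by simp
  exact hl.isClosedEmbedding (by fun_prop) h1

theorem dist_eq_sqrt_coords (e : Plane ≃ₗᵢ[ℝ] Plane) (x y : Plane) :
    dist x y = √((e x 0 - e y 0) ^ 2 + (e x 1 - e y 1) ^ 2) := by
  rw [← e.dist_map, EuclideanSpace.dist_eq]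
  simp [Fin.sum_univ_two, Real.dist_eq, sq_abs]

theorem abs_coord_sub_le_dist (e : Plane ≃ₗᵢ[ℝ] Plane) (x y : Plane) :
    |e x 0 - e y 0| ≤ dist x y := by
  rw [dist_eq_sqrt_coords e]
  exact Real.abs_le_sqrt (by nlinarith [sq_nonneg (e x 1 - e y 1)])

/-- The mean value theorem makes each chord an exact multiple of its base, which yields Lipschitz
bounds for the parametrization and for its inverse at once. -/
theorem exists_dist_graphMap_eq (e : Plane ≃ₗᵢ[ℝ] Plane) {γ : ℝ → ℝ} (hγ : ContDiff ℝ 1 γ)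
    {s t : ℝ} (hst : s < t) :
    ∃ ξ ∈ Icc s t, dist (graphMap e γ s 0) (graphMap e γ t 0) = graphSpeed γ ξ * (t - s) := by
  obtain ⟨ξ, hξ, h⟩ := exists_deriv_eq_slope γ hst hγ.continuous.continuousOn
    (hγ.differentiable one_ne_zero).differentiableOn
  refine ⟨ξ, Ioo_subset_Icc_self hξ, ?_⟩
  have hpos : 0 < t - s := sub_pos.2 hst
  rw [eq_div_iff hpos.ne'] at h
  rw [dist_eq_sqrt_coords e, graphSpeed]
  simp only [graphMap_zero_coord, graphMap_one_coord, add_zero]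
  conv_rhs => rw [← Real.sqrt_sq hpos.le, ← Real.sqrt_mul (by positivity)]
  congr 1
  have : γ s - γ t = -(deriv γ ξ * (t - s)) := by rw [h]; ring
  rw [this]; ring

/-- Arc length on a graph: the one-dimensional Hausdorff measure in the graph parametrization. -/
theorem hausdorffMeasure_restrict_graph (e : Plane ≃ₗᵢ[ℝ] Plane) {γ : ℝ → ℝ}
    (hγ : ContDiff ℝ 1 γ) :
    (Measure.hausdorffMeasure 1 : Measure Plane).restrict (range fun s => graphMap e γ s 0) =
      (volume.withDensity fun s => ENNReal.ofReal (graphSpeed γ s)).map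
        fun s => graphMap e γ s 0 := by
  have hemb := (isClosedEmbedding_graphMap e hγ.continuous).measurableEmbedding
  rw [← hemb.map_comap]
  congr 1
  refine measure_eq_withDensity_of_mean_value (continuous_graphSpeed hγ)
    (fun t => (graphSpeed_pos γ t).le) fun a b hab => ?_
  obtain ⟨ξ, hξ, hξm⟩ := isCompact_Icc.exists_isMinOn (nonempty_Icc.2 hab.le)
    (continuous_graphSpeed hγ).continuousOn
  obtain ⟨η, hη, hηm⟩ := isCompact_Icc.exists_isMaxOn (nonempty_Icc.2 hab.le)
    (continuous_graphSpeed hγ).continuousOn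
  have hd : ∀ s ∈ Ioc a b, ∀ t ∈ Ioc a b,
      graphSpeed γ ξ * dist s t ≤ dist (graphMap e γ s 0) (graphMap e γ t 0) ∧
      dist (graphMap e γ s 0) (graphMap e γ t 0) ≤ graphSpeed γ η * dist s t := by
    have main : ∀ s ∈ Ioc a b, ∀ t ∈ Ioc a b, s < t →
        graphSpeed γ ξ * dist s t ≤ dist (graphMap e γ s 0) (graphMap e γ t 0) ∧
        dist (graphMap e γ s 0) (graphMap e γ t 0) ≤ graphSpeed γ η * dist s t := by
      intro s hs t ht hlt
      obtain ⟨ζ, hζ, h⟩ := exists_dist_graphMap_eq e hγ hlt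
      have hζ' : ζ ∈ Icc a b := ⟨hs.1.le.trans hζ.1, hζ.2.trans ht.2⟩
      rw [h, dist_comm s t, Real.dist_eq, abs_of_pos (sub_pos.2 hlt)]
      exact ⟨mul_le_mul_of_nonneg_right (hξm hζ') (sub_pos.2 hlt).le,
        mul_le_mul_of_nonneg_right (hηm hζ') (sub_pos.2 hlt).le⟩
    intro s hs t ht
    rcases lt_trichotomy s t with h | h | h
    · exact main s hs t ht h
    · simp [h]
    · rw [dist_comm s, dist_comm (graphMap e γ s 0)]; exact main t ht s hs h
  refine ⟨ξ, hξ, η, hη, ?_, ?_⟩ <;> rw [hemb.comap_apply]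
  -- Lower bound: the first coordinate inverts the parametrization and contracts by the minimal
  -- speed.
  · have hlip : LipschitzOnWith (Real.toNNReal (graphSpeed γ ξ)⁻¹) (fun x : Plane => e x 0)
        ((fun s => graphMap e γ s 0) '' Ioc a b) := by
      refine LipschitzOnWith.of_dist_le_mul ?_
      rintro _ ⟨s, hs, rfl⟩ _ ⟨t, ht, rfl⟩
      rw [Real.coe_toNNReal _ (inv_nonneg.2 (graphSpeed_pos γ ξ).le)]
      simp only [graphMap_zero_coord]
      rw [inv_mul_eq_div, le_div_iff₀' (graphSpeed_pos γ ξ)]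
      exact (hd s hs t ht).1
    have := hlip.hausdorffMeasure_image_le (d := 1) zero_le_one
    rw [image_image] at this
    simp only [graphMap_zero_coord, image_id', hausdorffMeasure_real, Real.volume_Ioc,
      ENNReal.rpow_one] at this
    rw [ENNReal.ofReal_mul (graphSpeed_pos γ ξ).le]
    refine (mul_le_mul_right this _).trans ?_
    rw [← mul_assoc]
    change _ * ENNReal.ofReal _ * _ ≤ _
    rw [← ENNReal.ofReal_mul (graphSpeed_pos γ ξ).le, mul_inv_cancel₀ (graphSpeed_pos γ ξ).ne']
    simp
  -- Upper bound: the parametrization itself stretches by at most the maximal speed.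
  · have hlip : LipschitzOnWith (Real.toNNReal (graphSpeed γ η)) (fun s => graphMap e γ s 0)
        (Ioc a b) := by
      refine LipschitzOnWith.of_dist_le_mul fun s hs t ht => ?_
      rw [Real.coe_toNNReal _ (graphSpeed_pos γ η).le]
      exact (hd s hs t ht).2
    have := hlip.hausdorffMeasure_image_le (d := 1) zero_le_one
    rw [hausdorffMeasure_real, Real.volume_Ioc, ENNReal.rpow_one] at this
    rw [ENNReal.ofReal_mul (graphSpeed_pos γ η).le]
    exact this

/-! ### Boundary, normal and arc length in a graph chart. -/

/-- In the ball of radius `r` about `p`, the set `D` is the region strictly above the graph of the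
`C²` function `γ` in the orthonormal coordinates `e`. -/
structure IsGraphChart (D : Set Plane) (p : Plane) (e : Plane ≃ₗᵢ[ℝ] Plane) (γ : ℝ → ℝ)
    (r : ℝ) : Prop where
  contDiff : ContDiff ℝ 2 γ
  pos : 0 < r
  mem_iff : ∀ x ∈ Metric.ball p r, x ∈ D ↔ γ (e x 0) < e x 1

/-- The outward unit normal of the region above a graph. -/
noncomputable def graphNormal (e : Plane ≃ₗᵢ[ℝ] Plane) (γ : ℝ → ℝ) (s : ℝ) : Plane :=
  (graphSpeed γ s)⁻¹ • e.symm !₂[deriv γ s, -1]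

theorem inner_graphNormal (e : Plane ≃ₗᵢ[ℝ] Plane) (γ : ℝ → ℝ) (s : ℝ) (v : Plane) :
    ⟪v, graphNormal e γ s⟫ = (graphSpeed γ s)⁻¹ * (deriv γ s * e v 0 - e v 1) := by
  rw [graphNormal, real_inner_smul_right, ← LinearIsometryEquiv.inner_map_map e v,
    LinearIsometryEquiv.apply_symm_apply]
  congr 1
  simp [PiLp.inner_apply, Fin.sum_univ_two]
  ring

theorem norm_graphNormal (e : Plane ≃ₗᵢ[ℝ] Plane) (γ : ℝ → ℝ) (s : ℝ) :
    ‖graphNormal e γ s‖ = 1 := by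
  rw [graphNormal, norm_smul, LinearIsometryEquiv.norm_map, EuclideanSpace.norm_eq]
  simp only [Fin.sum_univ_two, Real.norm_eq_abs, sq_abs,
    abs_of_pos (inv_pos.2 (graphSpeed_pos γ s)), Matrix.cons_val_zero, Matrix.cons_val_one]
  rw [show deriv γ s ^ 2 + (-1) ^ 2 = 1 + deriv γ s ^ 2 by ring]
  exact inv_mul_cancel₀ (graphSpeed_pos γ s).ne'

theorem continuous_graphNormal (e : Plane ≃ₗᵢ[ℝ] Plane) {γ : ℝ → ℝ} (hγ : ContDiff ℝ 1 γ) :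
    Continuous (graphNormal e γ) := by
  have h1 := hγ.continuous_deriv le_rfl
  have h2 := (continuous_graphSpeed hγ).inv₀ fun s => (graphSpeed_pos γ s).ne'
  unfold graphNormal
  refine h2.smul ?_
  fun_prop

namespace IsGraphChart

variable {D : Set Plane} {p : Plane} {e : Plane ≃ₗᵢ[ℝ] Plane} {γ : ℝ → ℝ} {r : ℝ}

theorem mono (h : IsGraphChart D p e γ r) {q : Plane} {ρ : ℝ} (hρ : 0 < ρ)
    (hsub : Metric.ball q ρ ⊆ Metric.ball p r) : IsGraphChart D q e γ ρ :=
  ⟨h.contDiff, hρ, fun x hx => h.mem_iff x (hsub hx)⟩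

theorem notMem_closure (h : IsGraphChart D p e γ r) {x : Plane} (hx : x ∈ Metric.ball p r)
    (hlt : e x 1 < γ (e x 0)) : x ∉ closure D := by
  intro hcl
  have hγ := h.contDiff.continuous
  have hopen : IsOpen {y : Plane | y ∈ Metric.ball p r ∧ e y 1 < γ (e y 0)} := by
    apply Metric.isOpen_ball.inter
    exact isOpen_lt (by fun_prop) (hγ.comp (by fun_prop))
  obtain ⟨y, hy, hyD⟩ := mem_closure_iff.1 hcl _ hopen ⟨hx, hlt⟩
  exact absurd ((h.mem_iff y hy.1).1 hyD) hy.2.not_gt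

theorem eq_of_mem_frontier (h : IsGraphChart D p e γ r) (ho : IsOpen D) {x : Plane}
    (hx : x ∈ Metric.ball p r) (hxf : x ∈ frontier D) : e x 1 = γ (e x 0) := by
  rw [ho.frontier_eq] at hxf
  refine le_antisymm ?_ ?_
  · by_contra hlt
    exact hxf.2 ((h.mem_iff x hx).2 (not_le.1 hlt))
  · by_contra hlt
    exact h.notMem_closure hx (not_le.1 hlt) hxf.1

theorem isOutwardUnitNormal (h : IsGraphChart D p e γ r) (ho : IsOpen D) (hp : p ∈ frontier D) :
    IsOutwardUnitNormal D p (graphNormal e γ (e p 0)) := by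
  have hval := (h.eq_of_mem_frontier ho (Metric.mem_ball_self h.pos) hp).symm
  have hball : ∀ v : Plane, ∀ᶠ t : ℝ in 𝓝[>] 0, p + t • v ∈ Metric.ball p r := by
    intro v
    have hcont : ContinuousAt (fun t : ℝ => p + t • v) 0 := by fun_prop
    have : ∀ᶠ t : ℝ in 𝓝 0, p + t • v ∈ Metric.ball p r :=
      hcont (by simpa using Metric.ball_mem_nhds p h.pos)
    exact this.filter_mono nhdsWithin_le_nhds
  set c := deriv γ (e p 0) with hc
  -- The height above the graph along the ray `p + t v` has initial slope `-graphSpeed γ (e p 0) *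
  -- ⟪v, n⟫`, where `n` is the graph normal at `p`. Its sign decides on which side of the graph the
  -- ray starts.
  have hsl : ∀ v : Plane, Tendsto (fun t : ℝ => t⁻¹ *
      (e (p + t • v) 1 - γ (e (p + t • v) 0))) (𝓝[>] 0) (𝓝 (e v 1 - c * e v 0)) := by
    intro v
    have h0 : ∀ i, HasDerivAt (fun t : ℝ => e (p + t • v) i) (e v i) 0 := by
      intro i
      simpa using ((hasDerivAt_id (0 : ℝ)).mul_const (e v i)).const_add (e p i)
    have hg : HasDerivAt γ c (e (p + (0 : ℝ) • v) 0) := by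
      rw [zero_smul, add_zero]
      exact (h.contDiff.differentiable (by norm_num) (e p 0)).hasDerivAt
    have := (hasDerivAt_iff_tendsto_slope_zero.1 ((h0 1).sub (hg.comp (0 : ℝ) (h0 0)))).mono_left
      (nhdsWithin_mono 0 (fun t (ht : 0 < t) => ht.ne') : 𝓝[>] (0 : ℝ) ≤ 𝓝[≠] 0)
    simpa [hval] using this
  refine ⟨norm_graphNormal e γ _, fun v hv => ?_, fun v hv => ?_⟩
  · rw [real_inner_comm, inner_graphNormal] at hv
    have hv' : 0 < e v 1 - c * e v 0 := by
      have := neg_of_mul_neg_right hv (inv_pos.2 (graphSpeed_pos γ _)).le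
      linarith
    filter_upwards [hball v, (hsl v).eventually (lt_mem_nhds hv'), self_mem_nhdsWithin]
      with t h1 h2 h3
    have h4 := (pos_iff_pos_of_mul_pos h2).1 (inv_pos.2 h3)
    exact (h.mem_iff _ h1).2 (by linarith)
  · rw [real_inner_comm, inner_graphNormal] at hv
    have hv' : e v 1 - c * e v 0 < 0 := by
      have := (pos_iff_pos_of_mul_pos hv).1 (inv_pos.2 (graphSpeed_pos γ _))
      linarith
    filter_upwards [hball v, (hsl v).eventually (gt_mem_nhds hv'), self_mem_nhdsWithin]
      with t h1 h2 h3
    have h4 := neg_of_mul_neg_right h2 (inv_pos.2 h3).le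
    exact h.notMem_closure h1 (by linarith)

theorem outwardNormal_eq (h : IsGraphChart D p e γ r) (ho : IsOpen D) {x : Plane}
    (hx : x ∈ Metric.ball p r) (hxf : x ∈ frontier D) :
    outwardNormal D x = graphNormal e γ (e x 0) := by
  obtain ⟨ρ, hρ, hsub⟩ := Metric.isOpen_iff.1 Metric.isOpen_ball x hx
  have hn := (h.mono hρ hsub).isOutwardUnitNormal ho hxf
  have hex : ∃ n, IsOutwardUnitNormal D x n := ⟨_, hn⟩
  rw [outwardNormal, dif_pos hex]
  exact hex.choose_spec.unique hn

/-- A point on the graph is not in `D`, but arbitrarily small vertical upward shifts of it are. -/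
theorem mem_frontier_iff (h : IsGraphChart D p e γ r) (ho : IsOpen D) {x : Plane}
    (hx : x ∈ Metric.ball p r) : x ∈ frontier D ↔ e x 1 = γ (e x 0) := by
  refine ⟨h.eq_of_mem_frontier ho hx, fun hval => ?_⟩
  rw [ho.frontier_eq]
  refine ⟨?_, fun hxD => ((h.mem_iff x hx).1 hxD).ne' hval⟩
  have ht : Tendsto (fun t : ℝ => x + t • e.symm !₂[0, 1]) (𝓝[>] 0) (𝓝 x) := by
    have : ContinuousAt (fun t : ℝ => x + t • e.symm !₂[(0 : ℝ), 1]) 0 := by fun_prop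
    simpa using this.tendsto.mono_left (nhdsWithin_le_nhds (s := Ioi (0 : ℝ)))
  refine mem_closure_of_tendsto ht ?_
  filter_upwards [ht (Metric.isOpen_ball.mem_nhds hx), self_mem_nhdsWithin] with t h1 h2
  refine (h.mem_iff _ h1).2 ?_
  simpa [hval] using h2

theorem frontier_inter_ball (h : IsGraphChart D p e γ r) (ho : IsOpen D) :
    frontier D ∩ Metric.ball p r = (range fun s => graphMap e γ s 0) ∩ Metric.ball p r := by
  ext x
  refine and_congr_left fun hx => ?_
  rw [h.mem_frontier_iff ho hx]
  constructor
  · intro hval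
    refine ⟨e x 0, ?_⟩
    have := graphMap_coords e γ x
    rwa [hval, sub_self] at this
  · rintro ⟨s, rfl⟩
    simp

/-- Arc length near a boundary point in the graph parametrization. -/
theorem arcLength_restrict_ball (h : IsGraphChart D p e γ r) (ho : IsOpen D) :
    (arcLength D).restrict (Metric.ball p r) =
      ((volume.withDensity fun s => ENNReal.ofReal (graphSpeed γ s)).map
        fun s => graphMap e γ s 0).restrict (Metric.ball p r) := by
  rw [← hausdorffMeasure_restrict_graph e (h.contDiff.of_le (by norm_num)), arcLength,
    Measure.restrict_restrict Metric.isOpen_ball.measurableSet,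
    Measure.restrict_restrict Metric.isOpen_ball.measurableSet, inter_comm,
    h.frontier_inter_ball ho, inter_comm]

/-- Integration over the boundary of a function supported in a chart. -/
theorem integral_arcLength (h : IsGraphChart D p e γ r) (ho : IsOpen D) {f : Plane → ℝ}
    (hf : ∀ x ∉ Metric.ball p r, f x = 0) :
    ∫ x, f x ∂(arcLength D) = ∫ s, graphSpeed γ s * f (graphMap e γ s 0) := by
  have hγ : ContDiff ℝ 1 γ := h.contDiff.of_le (by norm_num)
  have h1 : ∀ μ : Measure Plane, ∫ x, f x ∂μ = ∫ x, f x ∂(μ.restrict (Metric.ball p r)) :=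
    fun μ => (setIntegral_eq_integral_of_forall_compl_eq_zero hf).symm
  rw [h1, h.arcLength_restrict_ball ho, ← h1,
    (isClosedEmbedding_graphMap e hγ.continuous).measurableEmbedding.integral_map,
    integral_withDensity_eq_integral_toReal_smul
      (continuous_graphSpeed hγ).measurable.ennreal_ofReal (by simp)]
  refine integral_congr_ae (Eventually.of_forall fun s => ?_)
  simp [ENNReal.toReal_ofReal (graphSpeed_pos γ s).le]

/-- An upper bound for boundary integrals over the ball of a chart. -/
theorem exists_setLIntegral_arcLength_le (h : IsGraphChart D p e γ r) (ho : IsOpen D) :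
    ∃ M : NNReal, ∀ f : Plane → ENNReal, Measurable f →
      ∫⁻ x in Metric.ball p r, f x ∂(arcLength D) ≤
        M * ∫⁻ s : ℝ in Ioo (e p 0 - r) (e p 0 + r), f (graphMap e γ s 0) := by
  have hγ : ContDiff ℝ 1 γ := h.contDiff.of_le (by norm_num)
  obtain ⟨M, hM⟩ := (isCompact_Icc (a := e p 0 - r) (b := e p 0 + r)).bddAbove_image
    (continuous_graphSpeed hγ).continuousOn
  refine ⟨M.toNNReal, fun f hf => ?_⟩
  have hemb := (isClosedEmbedding_graphMap e hγ.continuous).measurableEmbedding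
  have hmeas := (continuous_graphSpeed hγ).measurable.ennreal_ofReal
  have hfm : Measurable fun s => f (graphMap e γ s 0) := hf.comp hemb.measurable
  rw [h.arcLength_restrict_ball ho, hemb.restrict_map, hemb.lintegral_map,
    restrict_withDensity (hemb.measurable Metric.isOpen_ball.measurableSet),
    lintegral_withDensity_eq_lintegral_mul _ hmeas hfm]
  have hsub : (fun s => graphMap e γ s 0) ⁻¹' Metric.ball p r ⊆ Ioo (e p 0 - r) (e p 0 + r) := by
    intro s hs
    have h1 := (abs_coord_sub_le_dist e _ _).trans_lt (Metric.mem_ball.1 hs)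
    rw [graphMap_zero_coord, abs_lt] at h1
    constructor <;> linarith [h1.1, h1.2]
  refine (lintegral_mono_set hsub).trans ?_
  rw [← lintegral_const_mul _ hfm]
  refine setLIntegral_mono (hfm.const_mul _) fun s hs => ?_
  simp only [Pi.mul_apply]
  gcongr
  exact ENNReal.ofReal_le_ofReal (hM (mem_image_of_mem _ (Ioo_subset_Icc_self hs)))

end IsGraphChart

/-! ### Compactness of the boundary and continuity of the normal. -/

namespace IsBoundedC2Domain

variable {D : Set Plane}

theorem isCompact_frontier (hD : IsBoundedC2Domain D) : IsCompact (frontier D) :=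
  Metric.isCompact_of_isClosed_isBounded isClosed_frontier
    (hD.isBounded.closure.subset frontier_subset_closure)

theorem exists_isGraphChart (hD : IsBoundedC2Domain D) {p : Plane} (hp : p ∈ frontier D) :
    ∃ e γ r, IsGraphChart D p e γ r := by
  obtain ⟨e, γ, r, h1, h2, h3⟩ := hD.boundary p hp
  exact ⟨e, γ, r, h1, h2, h3⟩

theorem isOutwardUnitNormal (hD : IsBoundedC2Domain D) {p : Plane} (hp : p ∈ frontier D) :
    IsOutwardUnitNormal D p (outwardNormal D p) := by
  obtain ⟨e, γ, r, h⟩ := hD.exists_isGraphChart hp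
  rw [h.outwardNormal_eq hD.isOpen (Metric.mem_ball_self h.pos) hp]
  exact h.isOutwardUnitNormal hD.isOpen hp

theorem continuousOn_outwardNormal (hD : IsBoundedC2Domain D) :
    ContinuousOn (outwardNormal D) (frontier D) := by
  intro p hp
  obtain ⟨e, γ, r, h⟩ := hD.exists_isGraphChart hp
  have hc : Continuous fun x : Plane => graphNormal e γ (e x 0) :=
    (continuous_graphNormal e (h.contDiff.of_le (by norm_num))).comp (by fun_prop)
  refine hc.continuousWithinAt.congr_of_eventuallyEq_of_mem ?_ hp
  filter_upwards [self_mem_nhdsWithin,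
    mem_nhdsWithin_of_mem_nhds (Metric.ball_mem_nhds p h.pos)] with x h1 h2
  exact h.outwardNormal_eq hD.isOpen h2 h1

/-- Finitely many charts cover the boundary. -/
theorem exists_finite_cover (hD : IsBoundedC2Domain D) (c : ℝ) (hc : 0 < c) :
    ∃ T : Finset Plane, ∃ (e : Plane → Plane ≃ₗᵢ[ℝ] Plane) (γ : Plane → ℝ → ℝ) (r : Plane → ℝ),
      (∀ p ∈ T, p ∈ frontier D ∧ IsGraphChart D p (e p) (γ p) (r p)) ∧
      frontier D ⊆ ⋃ p ∈ T, Metric.ball p (c * r p) := by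
  classical
  have : ∀ p, ∃ (e : Plane ≃ₗᵢ[ℝ] Plane) (γ : ℝ → ℝ) (r : ℝ),
      p ∈ frontier D → IsGraphChart D p e γ r := by
    intro p
    by_cases hp : p ∈ frontier D
    · obtain ⟨e, γ, r, h⟩ := hD.exists_isGraphChart hp
      exact ⟨e, γ, r, fun _ => h⟩
    · exact ⟨.refl ℝ _, 0, 0, fun h => absurd h hp⟩
  choose e γ r h using this
  obtain ⟨T, hT, hcov⟩ := hD.isCompact_frontier.elim_nhds_subcover
    (fun p => Metric.ball p (c * r p))
    fun p hp => Metric.ball_mem_nhds p (mul_pos hc (h p hp).pos)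
  exact ⟨T, e, γ, r, fun p hp => ⟨hT p hp, h p (hT p hp)⟩, hcov⟩

end IsBoundedC2Domain

/-! ### The Gauss–Green formula in one chart. -/

/-- The horizontal derivative integrates to zero along horizontal lines because `c` is constant. The
vertical one leaves the boundary value, and `a` passes through the vertical integral because it
depends only on the first variable. -/
theorem setIntegral_halfPlane_fderiv {h : ℝ × ℝ → ℝ} (hh : ContDiff ℝ 1 h)
    (hc : HasCompactSupport h) {a : ℝ → ℝ} (ha : Continuous a) (c : ℝ) :
    ∫ z in univ ×ˢ Ioi (0 : ℝ), fderiv ℝ h z (c, a z.1) = - ∫ s, a s * h (s, 0) := by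
  have hdc : HasCompactSupport (fderiv ℝ h) := hc.fderiv ℝ
  have hcd : Continuous (fderiv ℝ h) := hh.continuous_fderiv one_ne_zero
  have hci : ∀ v : ℝ × ℝ, HasCompactSupport fun z => fderiv ℝ h z v := fun v =>
    hdc.comp_left (g := fun L : ℝ × ℝ →L[ℝ] ℝ => L v) rfl
  have hcc : ∀ v : ℝ × ℝ, Continuous fun z => fderiv ℝ h z v := fun v => by fun_prop
  have hdiff := hh.differentiable one_ne_zero
  have hI : ∀ b : ℝ → ℝ, Continuous b → ∀ v, Integrable (fun z : ℝ × ℝ => b z.1 * fderiv ℝ h z v)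
      ((volume.restrict univ).prod (volume.restrict (Ioi (0 : ℝ)))) := by
    intro b hb v
    rw [Measure.prod_restrict]
    refine Integrable.integrableOn ?_
    exact (Continuous.integrable_of_hasCompactSupport (by fun_prop) (hci v).mul_left)
  have h1 : ∀ t, ∫ s, fderiv ℝ h (s, t) (1, 0) = 0 := by
    intro t
    have hd : ∀ s, HasDerivAt (fun s => h (s, t)) (fderiv ℝ h (s, t) (1, 0)) s := fun s =>
      (hdiff (s, t)).hasFDerivAt.comp_hasDerivAt s ((hasDerivAt_id s).prodMk (hasDerivAt_const s t))
    have hemb : IsClosedEmbedding fun s : ℝ => (s, t) :=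
      Function.LeftInverse.isClosedEmbedding (f := Prod.fst) (fun _ => rfl) (by fun_prop) (by fun_prop)
    refine integral_eq_zero_of_hasDerivAt_of_integrable hd ?_ ?_
    · exact Continuous.integrable_of_hasCompactSupport (by fun_prop)
        ((hci (1, 0)).comp_isClosedEmbedding hemb)
    · exact Continuous.integrable_of_hasCompactSupport
        (hh.continuous.comp (by fun_prop)) (hc.comp_isClosedEmbedding hemb)
  have h2 : ∀ s, ∫ t in Ioi (0 : ℝ), fderiv ℝ h (s, t) (0, 1) = - h (s, 0) := by
    intro s
    have hemb : IsClosedEmbedding fun t : ℝ => (s, t) :=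
      Function.LeftInverse.isClosedEmbedding (f := Prod.snd) (fun _ => rfl) (by fun_prop) (by fun_prop)
    have hd : ∀ t, HasDerivAt (fun t => h (s, t)) (fderiv ℝ h (s, t) (0, 1)) t := fun t =>
      (hdiff (s, t)).hasFDerivAt.comp_hasDerivAt t ((hasDerivAt_const t s).prodMk (hasDerivAt_id t))
    have := HasCompactSupport.integral_Ioi_deriv_eq (f := fun t => h (s, t))
      (hh.comp (by fun_prop)) (hc.comp_isClosedEmbedding hemb) 0
    rw [← this]
    exact integral_congr_ae (Eventually.of_forall fun t => ((hd t).deriv).symm)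
  have hsplit : ∀ z : ℝ × ℝ, fderiv ℝ h z (c, a z.1) =
      c * fderiv ℝ h z (1, 0) + a z.1 * fderiv ℝ h z (0, 1) := by
    intro z
    have : ((c, a z.1) : ℝ × ℝ) = c • ((1, 0) : ℝ × ℝ) + a z.1 • ((0, 1) : ℝ × ℝ) := by simp
    rw [this, map_add, map_smul, map_smul, smul_eq_mul, smul_eq_mul]
  simp_rw [hsplit]
  have hvol : (volume : Measure (ℝ × ℝ)) = (volume : Measure ℝ).prod volume := rfl
  rw [hvol, ← Measure.prod_restrict, integral_add (hI (fun _ => c) continuous_const _) (hI a ha _),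
    integral_prod_symm _ (hI (fun _ => c) continuous_const _), integral_prod _ (hI a ha _)]
  simp only [Measure.restrict_univ, integral_const_mul, h1, h2, mul_zero, integral_zero, zero_add,
    mul_neg, integral_neg]

/-- The graph coordinates of the plane. -/
noncomputable def graphHomeomorph (e : Plane ≃ₗᵢ[ℝ] Plane) {γ : ℝ → ℝ} (hγ : Continuous γ) :
    ℝ × ℝ ≃ₜ Plane where
  toFun z := graphMap e γ z.1 z.2
  invFun x := (e x 0, e x 1 - γ (e x 0))
  left_inv z := by simp
  right_inv x := graphMap_coords e γ x
  continuous_toFun := continuous_graphMap e hγ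
  continuous_invFun := by
    refine Continuous.prodMk (by fun_prop) (Continuous.sub (by fun_prop) (hγ.comp (by fun_prop)))

/-- Flattening the graph is a shear followed by an isometry; translation invariance on vertical
lines gives the result for merely continuous `γ`. -/
theorem measurePreserving_graphMap (e : Plane ≃ₗᵢ[ℝ] Plane) {γ : ℝ → ℝ} (hγ : Continuous γ) :
    MeasurePreserving fun z : ℝ × ℝ => graphMap e γ z.1 z.2 := by
  have h1 : MeasurePreserving fun z : ℝ × ℝ => (z.1, γ z.1 + z.2) :=
    (MeasurePreserving.id volume).skew_product (g := fun s t => γ s + t)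
      (by unfold Function.uncurry; fun_prop)
      (Eventually.of_forall fun s => (measurePreserving_add_left volume (γ s)).map_eq)
  have h2 := ((volume_preserving_finTwoArrow ℝ).symm _).comp h1
  have h3 := e.symm.measurePreserving.comp ((PiLp.volume_preserving_toLp (Fin 2)).comp h2)
  convert h3 using 1
  funext z
  simp only [graphMap, Function.comp_apply]
  congr 2

/-- In flattened coordinates `v` becomes `(e v 0, e v 1 - γ' * e v 0)`. Its first component is
constant, and its second is minus the speed times `⟪v, ν⟫`, exactly what the half-plane formula
needs. Outside the ball `D` need not lie above the graph, but there `φ` vanishes. -/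
theorem IsGraphChart.integral_fderiv_eq {D : Set Plane} {p : Plane} {e : Plane ≃ₗᵢ[ℝ] Plane}
    {γ : ℝ → ℝ} {r : ℝ} (h : IsGraphChart D p e γ r) (ho : IsOpen D) {φ : Plane → ℝ}
    (hφ : ContDiff ℝ 1 φ) (hc : HasCompactSupport φ) (hs : tsupport φ ⊆ Metric.ball p r)
    (v : Plane) :
    ∫ x in D, fderiv ℝ φ x v = ∫ x, φ x * ⟪v, outwardNormal D x⟫ ∂(arcLength D) := by
  have hγ : ContDiff ℝ 1 γ := h.contDiff.of_le (by norm_num)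
  have hγc := hγ.continuous
  have hφ0 : ∀ x ∉ Metric.ball p r, φ x = 0 := fun x hx => image_eq_zero_of_notMem_tsupport
    fun hx' => hx (hs hx')
  have hφ1 : ∀ x ∉ Metric.ball p r, fderiv ℝ φ x v = 0 := by
    intro x hx
    have : x ∉ tsupport (fderiv ℝ φ) := fun hx' => hx (hs (tsupport_fderiv_subset ℝ hx'))
    rw [image_eq_zero_of_notMem_tsupport this]; rfl
  have hU : IsOpen {x : Plane | γ (e x 0) < e x 1} :=
    isOpen_lt (hγc.comp (by fun_prop)) (by fun_prop)
  have hset : ∫ x in D, fderiv ℝ φ x v = ∫ x in {x : Plane | γ (e x 0) < e x 1}, fderiv ℝ φ x v := by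
    rw [← integral_indicator ho.measurableSet, ← integral_indicator hU.measurableSet]
    congr 1
    ext x
    by_cases hx : x ∈ Metric.ball p r
    · have := h.mem_iff x hx
      simp only [indicator, mem_ofPred_eq, this]
    · simp [indicator, hφ1 x hx]
  have hpre : (fun z : ℝ × ℝ => graphMap e γ z.1 z.2) ⁻¹' {x : Plane | γ (e x 0) < e x 1} =
      univ ×ˢ Ioi (0 : ℝ) := by
    ext z; simp
  rw [hset, ← (measurePreserving_graphMap e hγc).setIntegral_preimage_emb
    (graphHomeomorph e hγc).measurableEmbedding, hpre]
  set k : ℝ × ℝ → ℝ := fun z => φ (graphMap e γ z.1 z.2) with hk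
  have hkc : HasCompactSupport k := hc.comp_homeomorph (graphHomeomorph e hγc)
  have hgd : ContDiff ℝ 1 fun z : ℝ × ℝ => graphMap e γ z.1 z.2 := by
    unfold graphMap
    refine e.symm.contDiff.comp ?_
    rw [contDiff_euclidean]
    intro i
    fin_cases i
    · exact contDiff_fst
    · exact (hγ.comp contDiff_fst).add contDiff_snd
  have hkd : ContDiff ℝ 1 k := hφ.comp hgd
  have hder : ∀ z : ℝ × ℝ, fderiv ℝ φ (graphMap e γ z.1 z.2) v =
      fderiv ℝ k z (e v 0, e v 1 - deriv γ z.1 * e v 0) := by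
    intro z
    have hl : HasDerivAt (fun t : ℝ => graphMap e γ (z.1 + t * e v 0)
        (z.2 + t * (e v 1 - deriv γ z.1 * e v 0))) v 0 := by
      have ha : HasDerivAt (fun t : ℝ => z.1 + t * e v 0) (e v 0) 0 := by
        simpa using ((hasDerivAt_id (0 : ℝ)).mul_const (e v 0)).const_add z.1
      have hb' : HasDerivAt (fun t : ℝ => z.2 + t * (e v 1 - deriv γ z.1 * e v 0))
          (e v 1 - deriv γ z.1 * e v 0) 0 := by
        simpa using ((hasDerivAt_id (0 : ℝ)).mul_const (e v 1 - deriv γ z.1 * e v 0)).const_add z.2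
      have hg : HasDerivAt γ (deriv γ z.1) (z.1 + 0 * e v 0) := by
        simpa using (hγ.differentiable one_ne_zero z.1).hasDerivAt
      have hpair : HasDerivAt (fun t : ℝ => (!₂[z.1 + t * e v 0, γ (z.1 + t * e v 0) +
          (z.2 + t * (e v 1 - deriv γ z.1 * e v 0))] : Plane)) (e v) 0 := by
        have hpi : HasDerivAt (fun t : ℝ => ![z.1 + t * e v 0, γ (z.1 + t * e v 0) +
            (z.2 + t * (e v 1 - deriv γ z.1 * e v 0))]) (e v).ofLp 0 := by
          rw [hasDerivAt_pi]
          intro i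
          fin_cases i
          · simpa using ha
          · have := (hg.comp (0 : ℝ) ha).add hb'
            refine this.congr_deriv ?_
            simp
        exact (EuclideanSpace.equiv (Fin 2) ℝ).symm.toContinuousLinearMap.hasFDerivAt.comp_hasDerivAt
          (0 : ℝ) hpi
      have := e.symm.toContinuousLinearEquiv.toContinuousLinearMap.hasFDerivAt.comp_hasDerivAt
        (0 : ℝ) hpair
      refine this.congr_deriv ?_
      simp
    have hl2 : HasDerivAt (fun t : ℝ => z + t • (e v 0, e v 1 - deriv γ z.1 * e v 0))
        (e v 0, e v 1 - deriv γ z.1 * e v 0) 0 := by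
      simpa using ((hasDerivAt_id (0 : ℝ)).smul_const
        (e v 0, e v 1 - deriv γ z.1 * e v 0)).const_add z
    have h1 := HasFDerivAt.comp_hasDerivAt (0 : ℝ) (f := fun t : ℝ => graphMap e γ (z.1 + t * e v 0)
        (z.2 + t * (e v 1 - deriv γ z.1 * e v 0))) (l := φ)
        ((hφ.differentiable one_ne_zero _).hasFDerivAt) hl
    have h2 := HasFDerivAt.comp_hasDerivAt (0 : ℝ)
      (f := fun t : ℝ => z + t • (e v 0, e v 1 - deriv γ z.1 * e v 0)) (l := k)
        ((hkd.differentiable one_ne_zero _).hasFDerivAt) hl2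
    have h3 := h1.unique h2
    simpa using h3
  simp_rw [hder]
  have hdc : Continuous (deriv γ) := hγ.continuous_deriv le_rfl
  rw [setIntegral_halfPlane_fderiv hkd hkc (a := fun s => e v 1 - deriv γ s * e v 0) (by fun_prop)]
  rw [← integral_neg, h.integral_arcLength ho (fun x hx => by rw [hφ0 x hx, zero_mul])]
  refine integral_congr_ae (Eventually.of_forall fun s => ?_)
  simp only [hk]
  by_cases hx : graphMap e γ s 0 ∈ Metric.ball p r
  · rw [h.outwardNormal_eq ho hx ((h.mem_frontier_iff ho hx).2 (by simp)), inner_graphNormal]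
    have := (graphSpeed_pos γ s).ne'
    simp only [graphMap_zero_coord]
    field_simp
    ring
  · rw [hφ0 _ hx]; simp

/-! ### Finiteness of arc length and weakly singular boundary integrals. -/

theorem setLIntegral_enorm_rpow_neg_half_lt_top :
    ∫⁻ s in Icc (-1 : ℝ) 1, ‖s‖ₑ ^ (-(1 / 2) : ℝ) < ⊤ := by
  have hpos : ∫⁻ s in Ioc (0 : ℝ) 1, ‖s‖ₑ ^ (-(1 / 2) : ℝ) < ⊤ := by
    have h := (intervalIntegral.intervalIntegrable_rpow' (a := 0) (b := 1)
      (r := -(1 / 2)) (by norm_num)).1.lintegral_lt_top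
    refine lt_of_le_of_lt (le_of_eq ?_) h
    refine setLIntegral_congr_fun measurableSet_Ioc fun s hs => ?_
    rw [← ENNReal.ofReal_rpow_of_pos hs.1, ← Real.enorm_of_nonneg hs.1.le]
  have hneg : ∫⁻ s in Ico (-1 : ℝ) 0, ‖s‖ₑ ^ (-(1 / 2) : ℝ) < ⊤ := by
    have := (Measure.measurePreserving_neg (volume : Measure ℝ)).setLIntegral_comp_preimage_emb
      (MeasurableEquiv.neg ℝ).measurableEmbedding (fun s => ‖s‖ₑ ^ (-(1 / 2) : ℝ)) (Ioc 0 1)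
    simp only [enorm_neg] at this
    rw [show Neg.neg ⁻¹' Ioc (0 : ℝ) 1 = Ico (-1) 0 by simp] at this
    rw [this]
    exact hpos
  refine lt_of_le_of_lt ?_ (ENNReal.add_lt_top.2 ⟨hpos, hneg⟩)
  refine le_trans ?_ (lintegral_union_le _ _ _)
  have h1 : Ioc (0 : ℝ) 1 ∪ Ico (-1) 0 = Icc (-1) 1 \ {0} := by
    ext s
    simp only [mem_union, mem_Ioc, mem_Ico, Set.mem_sdiff, mem_Icc, mem_singleton_iff]
    constructor
    · rintro (h | h)
      · exact ⟨⟨by linarith, h.2⟩, h.1.ne'⟩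
      · exact ⟨⟨h.1, by linarith⟩, h.2.ne⟩
    · rintro ⟨h, h0⟩
      rcases lt_or_gt_of_ne h0 with h' | h'
      · exact Or.inr ⟨h.1, h'⟩
      · exact Or.inl ⟨h', h.2⟩
  rw [h1]
  exact (setLIntegral_congr (sdiff_null_ae_eq_self (μ := volume) (measure_singleton (0 : ℝ)))).ge

/-- Within distance one of `c` the integral is at most a translate of the fixed one over `[-1, 1]`;
farther away the integrand is at most one. This makes `K` independent of `c`. -/
theorem exists_setLIntegral_rpow_neg_half_le : ∃ K : NNReal, ∀ a b c : ℝ,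
    ∫⁻ s in Ioo a b, ‖c - s‖ₑ ^ (-(1 / 2) : ℝ) ≤ K + ENNReal.ofReal (b - a) := by
  refine ⟨(∫⁻ s in Icc (-1 : ℝ) 1, ‖s‖ₑ ^ (-(1 / 2) : ℝ)).toNNReal, fun a b c => ?_⟩
  rw [ENNReal.coe_toNNReal setLIntegral_enorm_rpow_neg_half_lt_top.ne]
  have htrans := (Measure.measurePreserving_sub_left (volume : Measure ℝ) c).setLIntegral_comp_preimage_emb
    (MeasurableEquiv.subLeft c).measurableEmbedding (fun s => ‖s‖ₑ ^ (-(1 / 2) : ℝ)) (Icc (-1) 1)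
  rw [← htrans]
  have hmeas : MeasurableSet ((fun s => c - s) ⁻¹' Icc (-1 : ℝ) 1) :=
    (by fun_prop : Measurable fun s : ℝ => c - s) measurableSet_Icc
  rw [← lintegral_inter_add_sdiff _ (Ioo a b) hmeas]
  refine add_le_add (lintegral_mono_set inter_subset_right) ?_
  calc ∫⁻ s in Ioo a b \ (fun s => c - s) ⁻¹' Icc (-1 : ℝ) 1, ‖c - s‖ₑ ^ (-(1 / 2) : ℝ)
      ≤ ∫⁻ s in Ioo a b \ (fun s => c - s) ⁻¹' Icc (-1 : ℝ) 1, 1 := by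
        refine setLIntegral_mono measurable_const fun s hs => ?_
        have h1 : (1 : ENNReal) ≤ ‖c - s‖ₑ := by
          have : 1 ≤ ‖c - s‖ := by
            by_contra hlt
            rw [not_le, Real.norm_eq_abs, abs_lt] at hlt
            exact hs.2 ⟨hlt.1.le, hlt.2.le⟩
          rw [← ofReal_norm]
          simpa using ENNReal.ofReal_le_ofReal this
        rw [ENNReal.rpow_neg]
        exact ENNReal.inv_le_one.2 (ENNReal.one_le_rpow h1 (by norm_num))
    _ ≤ ∫⁻ s in Ioo a b, 1 := lintegral_mono_set sdiff_subset
    _ = ENNReal.ofReal (b - a) := by simp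

theorem arcLength_restrict_frontier (D : Set Plane) :
    (arcLength D).restrict (frontier D) = arcLength D := by
  rw [arcLength, Measure.restrict_restrict isClosed_frontier.measurableSet, inter_self]

namespace IsBoundedC2Domain

variable {D : Set Plane}

theorem exists_lintegral_arcLength_le (hD : IsBoundedC2Domain D) :
    ∃ (T : Finset Plane) (e : Plane → Plane ≃ₗᵢ[ℝ] Plane) (γ : Plane → ℝ → ℝ)
      (a b : Plane → ℝ) (M : Plane → NNReal), ∀ f : Plane → ENNReal, Measurable f →
      ∫⁻ x, f x ∂(arcLength D) ≤
        ∑ p ∈ T, M p * ∫⁻ s : ℝ in Ioo (a p) (b p), f (graphMap (e p) (γ p) s 0) := by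
  classical
  obtain ⟨T, e, γ, r, hT, hcov⟩ := hD.exists_finite_cover 1 one_pos
  have : ∀ p, ∃ M : NNReal, p ∈ T → ∀ f : Plane → ENNReal, Measurable f →
      ∫⁻ x in Metric.ball p (r p), f x ∂(arcLength D) ≤
        M * ∫⁻ s : ℝ in Ioo (e p p 0 - r p) (e p p 0 + r p), f (graphMap (e p) (γ p) s 0) := by
    intro p
    by_cases hp : p ∈ T
    · obtain ⟨M, hM⟩ := (hT p hp).2.exists_setLIntegral_arcLength_le hD.isOpen
      exact ⟨M, fun _ => hM⟩
    · exact ⟨0, fun h => absurd h hp⟩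
  choose M hM using this
  refine ⟨T, e, γ, fun p => e p p 0 - r p, fun p => e p p 0 + r p, M, fun f hf => ?_⟩
  refine le_trans ?_ (Finset.sum_le_sum fun p hp => hM p hp f hf)
  simp only [one_mul] at hcov
  rw [← Finset.tsum_subtype T fun p => ∫⁻ x in Metric.ball p (r p), f x ∂(arcLength D)]
  refine le_trans ?_ (lintegral_iUnion_le _ _)
  conv_lhs => rw [← arcLength_restrict_frontier D]
  refine lintegral_mono_set (hcov.trans ?_)
  rw [iUnion_subtype]

theorem isFiniteMeasure_arcLength (hD : IsBoundedC2Domain D) : IsFiniteMeasure (arcLength D) := by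
  obtain ⟨T, e, γ, a, b, M, h⟩ := hD.exists_lintegral_arcLength_le
  refine ⟨?_⟩
  have := h (fun _ => 1) measurable_const
  simp only [lintegral_const, one_mul, Measure.restrict_apply_univ, Real.volume_Ioo] at this
  refine this.trans_lt (ENNReal.sum_lt_top.2 fun p _ => ?_)
  exact ENNReal.mul_lt_top ENNReal.coe_lt_top ENNReal.ofReal_lt_top

/-- Projection to the first chart coordinate shortens distances, so the negative power is controlled
by the one-dimensional integral. The constant holds for all `x`, including points on the boundary.
-/
theorem exists_lintegral_rpow_neg_half_le (hD : IsBoundedC2Domain D) :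
    ∃ C : NNReal, ∀ x : Plane, ∫⁻ y, ‖x - y‖ₑ ^ (-(1 / 2) : ℝ) ∂(arcLength D) ≤ C := by
  obtain ⟨T, e, γ, a, b, M, h⟩ := hD.exists_lintegral_arcLength_le
  obtain ⟨K, hK⟩ := exists_setLIntegral_rpow_neg_half_le
  refine ⟨∑ p ∈ T, M p * (K + Real.toNNReal (b p - a p)), fun x => ?_⟩
  refine (h _ (by fun_prop)).trans ?_
  push_cast
  refine Finset.sum_le_sum fun p _ => mul_le_mul_right ?_ _
  refine le_trans (lintegral_mono fun s => ?_) (hK (a p) (b p) (e p x 0))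
  rw [ENNReal.rpow_neg, ENNReal.rpow_neg]
  refine ENNReal.inv_le_inv.2 (ENNReal.rpow_le_rpow ?_ (by norm_num))
  rw [← edist_eq_enorm_sub, ← edist_eq_enorm_sub, edist_dist, edist_dist]
  refine ENNReal.ofReal_le_ofReal ?_
  have := abs_coord_sub_le_dist (e p) x (graphMap (e p) (γ p) s 0)
  rwa [graphMap_zero_coord] at this

theorem integrable_arcLength_of_continuousOn (hD : IsBoundedC2Domain D) {f : Plane → ℝ}
    (hf : ContinuousOn f (frontier D)) : Integrable f (arcLength D) := by
  have := hD.isFiniteMeasure_arcLength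
  obtain ⟨C, hC⟩ := hD.isCompact_frontier.exists_bound_of_continuousOn hf
  refine Integrable.of_bound (C := C) (hf.aestronglyMeasurable isClosed_frontier.measurableSet) ?_
  exact (ae_restrict_mem isClosed_frontier.measurableSet).mono hC

theorem continuousOn_inner_outwardNormal (hD : IsBoundedC2Domain D) (v : Plane) :
    ContinuousOn (fun x => ⟪v, outwardNormal D x⟫) (frontier D) :=
  continuousOn_const.inner hD.continuousOn_outwardNormal

/-! ### Globalizing the Gauss–Green formula. -/

/-- Each induction step splits `k = ρ q * k + (1 - ρ q) * k`: the first piece is covered by the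
local formula, the second passes to the next product. Only the remainder `∏ (1 - ρ p) * φ` is left,
so the cutoffs need not sum to one. -/
theorem integral_fderiv_eq_of_partition (hD : IsBoundedC2Domain D) (v : Plane)
    (T : Finset Plane) (ρ : Plane → Plane → ℝ) (hρ : ∀ p ∈ T, ContDiff ℝ 1 (ρ p))
    (hloc : ∀ p ∈ T, ∀ φ : Plane → ℝ, ContDiff ℝ 1 φ → HasCompactSupport φ →
      ∫ x in D, fderiv ℝ (fun x => ρ p x * φ x) x v =
        ∫ x, (ρ p x * φ x) * ⟪v, outwardNormal D x⟫ ∂(arcLength D)) :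
    ∀ φ : Plane → ℝ, ContDiff ℝ 1 φ → HasCompactSupport φ →
      (∫ x in D, fderiv ℝ (fun x => (∏ p ∈ T, (1 - ρ p x)) * φ x) x v =
        ∫ x, ((∏ p ∈ T, (1 - ρ p x)) * φ x) * ⟪v, outwardNormal D x⟫ ∂(arcLength D)) →
      ∫ x in D, fderiv ℝ φ x v = ∫ x, φ x * ⟪v, outwardNormal D x⟫ ∂(arcLength D) := by
  classical
  induction T using Finset.induction_on with
  | empty => intro φ _ _ h; simpa using h
  | insert q S hq ih =>
    intro φ hφ hc h
    refine ih (fun p hp => hρ p (Finset.mem_insert_of_mem hp))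
      (fun p hp => hloc p (Finset.mem_insert_of_mem hp)) φ hφ hc ?_
    set k : Plane → ℝ := fun x => (∏ p ∈ S, (1 - ρ p x)) * φ x with hk
    have hkd : ContDiff ℝ 1 k := (contDiff_prod fun p hp =>
      contDiff_const.sub (hρ p (Finset.mem_insert_of_mem hp))).mul hφ
    have hkc : HasCompactSupport k := hc.mul_left
    have hqd := hρ q (Finset.mem_insert_self q S)
    have h1 := hloc q (Finset.mem_insert_self q S) k hkd hkc
    have h2 : (fun x => (∏ p ∈ insert q S, (1 - ρ p x)) * φ x) = fun x => k x - ρ q x * k x := by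
      funext x
      rw [Finset.prod_insert hq, hk]
      ring
    have hqk : ContDiff ℝ 1 fun x => ρ q x * k x := hqd.mul hkd
    have hqc : HasCompactSupport fun x => ρ q x * k x := hkc.mul_left
    have hint : ∀ g : Plane → ℝ, ContDiff ℝ 1 g → HasCompactSupport g →
        IntegrableOn (fun x => fderiv ℝ g x v) D := by
      intro g hg hgc
      refine Integrable.integrableOn ?_
      refine Continuous.integrable_of_hasCompactSupport ?_ ?_
      · have := hg.continuous_fderiv one_ne_zero
        fun_prop
      · exact (hgc.fderiv ℝ).comp_left (g := fun L : Plane →L[ℝ] ℝ => L v) rfl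
    have hbd : ∀ g : Plane → ℝ, ContDiff ℝ 1 g →
        Integrable (fun x => g x * ⟪v, outwardNormal D x⟫) (arcLength D) := fun g hg =>
      hD.integrable_arcLength_of_continuousOn
        (hg.continuous.continuousOn.mul (hD.continuousOn_inner_outwardNormal v))
    have h2' : ∀ x, (∏ p ∈ insert q S, (1 - ρ p x)) * φ x = k x - ρ q x * k x :=
      fun x => congrFun h2 x
    simp only [h2'] at h
    have h3 : ∀ x, fderiv ℝ (fun x => k x - ρ q x * k x) x v =
        fderiv ℝ k x v - fderiv ℝ (fun x => ρ q x * k x) x v := by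
      intro x
      rw [fderiv_fun_sub (hkd.differentiable one_ne_zero x) (hqk.differentiable one_ne_zero x)]
      rfl
    simp only [h3, sub_mul] at h
    rw [integral_sub (hint k hkd hkc) (hint _ hqk hqc), integral_sub (hbd k hkd) (hbd _ hqk),
      h1, sub_left_inj] at h
    exact h

/-- The function cut off to `D` is C¹ with compact support, because `φ` vanishes near the boundary;
a directional derivative of such a function has zero integral over the plane. -/
theorem integral_fderiv_eq_of_eventuallyEq_zero (hD : IsBoundedC2Domain D) (v : Plane)
    {φ : Plane → ℝ} (hφ : ContDiff ℝ 1 φ) (hz : ∀ x ∈ frontier D, φ =ᶠ[𝓝 x] 0) :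
    ∫ x in D, fderiv ℝ φ x v = ∫ x, φ x * ⟪v, outwardNormal D x⟫ ∂(arcLength D) := by
  have hR : ∫ x, φ x * ⟪v, outwardNormal D x⟫ ∂(arcLength D) = 0 := by
    refine integral_eq_zero_of_ae ?_
    filter_upwards [ae_restrict_mem isClosed_frontier.measurableSet] with x hx
    simp [(hz x hx).self_of_nhds]
  set k : Plane → ℝ := D.indicator φ with hk
  have hloc : ∀ x, (k =ᶠ[𝓝 x] φ ∧ x ∈ D) ∨ (k =ᶠ[𝓝 x] 0 ∧ x ∉ D) := by
    intro x
    by_cases hx : x ∈ D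
    · left
      exact ⟨by filter_upwards [hD.isOpen.mem_nhds hx] with y hy using indicator_of_mem hy φ, hx⟩
    · right
      refine ⟨?_, hx⟩
      by_cases hxf : x ∈ frontier D
      · filter_upwards [hz x hxf] with y hy
        simp only [hk, indicator]
        split_ifs <;> simp [hy]
      · have hcl : x ∉ closure D := fun h => hxf (by rw [hD.isOpen.frontier_eq]; exact ⟨h, hx⟩)
        filter_upwards [isClosed_closure.isOpen_compl.mem_nhds hcl] with y hy
        exact indicator_of_notMem (fun h => hy (subset_closure h)) φ
  have hkd : ContDiff ℝ 1 k := by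
    rw [contDiff_iff_contDiffAt]
    intro x
    rcases hloc x with ⟨h, -⟩ | ⟨h, -⟩
    · exact hφ.contDiffAt.congr_of_eventuallyEq h
    · exact contDiffAt_const.congr_of_eventuallyEq h
  have hkc : HasCompactSupport k := by
    refine HasCompactSupport.of_support_subset_isCompact
      (Metric.isCompact_of_isClosed_isBounded isClosed_closure hD.isBounded.closure) ?_
    exact (support_indicator_subset (s := D)).trans subset_closure
  have hkf : D.indicator (fun x => fderiv ℝ φ x v) = fun x => fderiv ℝ k x v := by
    funext x
    rcases hloc x with ⟨h, hx⟩ | ⟨h, hx⟩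
    · rw [indicator_of_mem hx, h.fderiv_eq]
    · rw [indicator_of_notMem hx, h.fderiv_eq]; simp
  rw [hR, ← integral_indicator hD.isOpen.measurableSet, hkf]
  have hki : Integrable (fun x => fderiv ℝ k x v) := by
    refine Continuous.integrable_of_hasCompactSupport ?_ ?_
    · have := hkd.continuous_fderiv one_ne_zero
      fun_prop
    · exact (hkc.fderiv ℝ).comp_left (g := fun L : Plane →L[ℝ] ℝ => L v) rfl
  have := integral_mul_fderiv_eq_neg_fderiv_mul_of_integrable (μ := (volume : Measure Plane))
    (f := fun _ => (1 : ℝ)) (g := k) (v := v) (by simp) (by simpa using hki)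
    (by simpa using hkd.continuous.integrable_of_hasCompactSupport hkc)
    (fun x _ => differentiableAt_const _) (fun x _ => hkd.differentiable one_ne_zero x)
  simpa using this

/-- The **Gauss–Green formula** on a bounded planar domain with `C²` boundary. -/
theorem integral_fderiv_eq (hD : IsBoundedC2Domain D) {φ : Plane → ℝ} (hφ : ContDiff ℝ 1 φ)
    (v : Plane) :
    ∫ x in D, fderiv ℝ φ x v = ∫ x, φ x * ⟪v, outwardNormal D x⟫ ∂(arcLength D) := by
  classical
  have hcpt : ∀ φ : Plane → ℝ, ContDiff ℝ 1 φ → HasCompactSupport φ →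
      ∫ x in D, fderiv ℝ φ x v = ∫ x, φ x * ⟪v, outwardNormal D x⟫ ∂(arcLength D) := by
    intro φ hφ hc
    -- The half-radius balls cover the boundary. Each bump is one on its half-radius ball and
    -- supported in the ball of radius `3/4 * r p`, inside the chart; hence `∏ (1 - b p)` vanishes
    -- near the boundary.
    obtain ⟨T, e, γ, r, hT, hcov⟩ := hD.exists_finite_cover (1 / 2) (by norm_num)
    have hb : ∀ p, ∃ b : ContDiffBump p, p ∈ T → b.rIn = r p / 2 ∧ b.rOut = 3 / 4 * r p := by
      intro p
      by_cases hp : p ∈ T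
      · have := (hT p hp).2.pos
        exact ⟨⟨r p / 2, 3 / 4 * r p, by linarith, by linarith⟩, fun _ => ⟨rfl, rfl⟩⟩
      · exact ⟨⟨1, 2, by norm_num, by norm_num⟩, fun h => absurd h hp⟩
    choose b hb using hb
    refine hD.integral_fderiv_eq_of_partition v T (fun p => b p)
      (fun p _ => (b p).contDiff) ?_ φ hφ hc ?_
    · intro p hp k hk hkc
      refine (hT p hp).2.integral_fderiv_eq hD.isOpen ((b p).contDiff.mul hk) hkc.mul_left ?_ v
      refine (tsupport_mul_subset_left (f := b p) (g := k)).trans ?_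
      rw [(b p).tsupport_eq, (hb p hp).2]
      exact Metric.closedBall_subset_ball (by linarith [(hT p hp).2.pos])
    · refine hD.integral_fderiv_eq_of_eventuallyEq_zero v
        ((contDiff_prod fun p _ => contDiff_const.sub (b p).contDiff).mul hφ) fun x hx => ?_
      obtain ⟨p, hp, hxp⟩ := mem_iUnion₂.1 (hcov hx)
      filter_upwards [Metric.isOpen_ball.mem_nhds hxp] with y hy
      have h1 : b p y = 1 := by
        apply (b p).one_of_mem_closedBall
        rw [(hb p hp).1]
        exact Metric.ball_subset_closedBall (by rwa [one_div, inv_mul_eq_div] at hy)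
      have : ∏ p ∈ T, (1 - b p y) = 0 := Finset.prod_eq_zero hp (by rw [h1, sub_self])
      simp [this]
  obtain ⟨R, hR⟩ := hD.isBounded.closure.subset_ball 0
  have hRpos : 0 < max R 1 := by positivity
  -- A cutoff equal to one near `closure D` removes the assumption of compact support.
  let χ : ContDiffBump (0 : Plane) := ⟨max R 1, max R 1 + 1, hRpos, by linarith⟩
  have hχ : ∀ x ∈ closure D, χ x = 1 ∧ fderiv ℝ (fun x => χ x * φ x) x = fderiv ℝ φ x := by
    intro x hx
    have hxb : x ∈ Metric.ball (0 : Plane) (max R 1) :=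
      Metric.ball_subset_ball (le_max_left _ _) (hR hx)
    have he := χ.eventuallyEq_one_of_mem_ball hxb
    refine ⟨he.self_of_nhds, Filter.EventuallyEq.fderiv_eq ?_⟩
    filter_upwards [he] with y hy
    simp [hy]
  have := hcpt (fun x => χ x * φ x) (χ.contDiff.mul hφ) χ.hasCompactSupport.mul_right
  rw [setIntegral_congr_fun (g := fun x => fderiv ℝ φ x v) hD.isOpen.measurableSet
    (fun x hx => by simp only [(hχ x (subset_closure hx)).2])] at this
  rw [this]
  refine integral_congr_ae ?_
  filter_upwards [ae_restrict_mem isClosed_frontier.measurableSet] with x hx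
  rw [(hχ x (frontier_subset_closure hx)).1, one_mul]

end IsBoundedC2Domain

/-! ### Differentiating layer potentials. -/

/-- The convolution `∫_{∂D} k(x - y) f(y) ds(y)` of a kernel with a density on the boundary. -/
noncomputable def layer (D : Set Plane) (f : Plane → ℝ) (k : Plane → ℝ) (x : Plane) : ℝ :=
  ∫ y, k (x - y) * f y ∂(arcLength D)

namespace IsBoundedC2Domain

variable {D : Set Plane} {f : Plane → ℝ} {k : Plane → ℝ} {O : Set Plane}

theorem aestronglyMeasurable_layer_kernel {E : Type*} [NormedAddCommGroup E] {k : Plane → E}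
    (hk : ContinuousOn k O) {x : Plane} (hx : ∀ y ∈ frontier D, x - y ∈ O) :
    AEStronglyMeasurable (fun y => k (x - y)) (arcLength D) :=
  ContinuousOn.aestronglyMeasurable (hk.comp (by fun_prop) hx) isClosed_frontier.measurableSet

theorem integrable_layer_kernel (hD : IsBoundedC2Domain D) (hf : Integrable f (arcLength D))
    (hk : ContinuousOn k O) {x : Plane} (hx : ∀ y ∈ frontier D, x - y ∈ O) :
    Integrable (fun y => k (x - y) * f y) (arcLength D) := by
  obtain ⟨C, hC⟩ := hD.isCompact_frontier.exists_bound_of_continuousOn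
    (f := fun y => k (x - y)) (hk.comp (by fun_prop) hx)
  exact hf.bdd_mul (c := C) (aestronglyMeasurable_layer_kernel hk hx)
    ((ae_restrict_mem isClosed_frontier.measurableSet).mono hC)

/-- Differentiation under the integral: the compact set `x - ∂D` has a compact thickening inside
`O`, on which the derivative of `k` is bounded. Taking `O = univ` serves the regularized kernels,
and `O = {0}ᶜ` the singular ones at points of `D`. -/
theorem hasFDerivAt_layer (hD : IsBoundedC2Domain D) (hf : Integrable f (arcLength D))
    (hO : IsOpen O) (hk : ContDiffOn ℝ 1 k O) {x : Plane} (hx : ∀ y ∈ frontier D, x - y ∈ O) :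
    ∃ L : Plane →L[ℝ] ℝ, HasFDerivAt (layer D f k) L x ∧
      ∀ v, L v = layer D f (fun z => fderiv ℝ k z v) x := by
  have hdk : ContinuousOn (fderiv ℝ k) O := hk.continuousOn_fderiv_of_isOpen hO le_rfl
  have hS : IsCompact ((fun y => x - y) '' frontier D) :=
    hD.isCompact_frontier.image (by fun_prop)
  obtain ⟨δ, hδ, hsub⟩ := hS.exists_cthickening_subset_open hO (image_subset_iff.2 hx)
  obtain ⟨C, hC⟩ := hS.cthickening.exists_bound_of_continuousOn (hdk.mono hsub)
  have hmem : ∀ y ∈ frontier D, ∀ z ∈ Metric.ball x δ,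
      z - y ∈ Metric.cthickening δ ((fun y => x - y) '' frontier D) := by
    intro y hy z hz
    refine Metric.mem_cthickening_of_dist_le _ (x - y) _ _ (mem_image_of_mem _ hy) ?_
    rw [dist_sub_right]
    exact (Metric.mem_ball.1 hz).le
  have hae : ∀ᵐ y ∂(arcLength D), y ∈ frontier D := ae_restrict_mem isClosed_frontier.measurableSet
  have hF'meas : AEStronglyMeasurable (fun y => f y • fderiv ℝ k (x - y)) (arcLength D) :=
    hf.1.smul (aestronglyMeasurable_layer_kernel hdk hx)
  have hbound : ∀ᵐ y ∂(arcLength D), ∀ z ∈ Metric.ball x δ,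
      ‖f y • fderiv ℝ k (z - y)‖ ≤ |f y| * C := by
    filter_upwards [hae] with y hy z hz
    rw [norm_smul, Real.norm_eq_abs]
    exact mul_le_mul_of_nonneg_left (hC _ (hmem y hy z hz)) (abs_nonneg _)
  have hbi : Integrable (fun y => |f y| * C) (arcLength D) := hf.abs.mul_const C
  have hmain := hasFDerivAt_integral_of_dominated_of_fderiv_le (𝕜 := ℝ) (μ := arcLength D)
    (F := fun z y => k (z - y) * f y) (F' := fun z y => f y • fderiv ℝ k (z - y)) (x₀ := x)
    (bound := fun y => |f y| * C) (Metric.ball_mem_nhds x hδ) ?_ ?_ hF'meas hbound hbi ?_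
  · refine ⟨_, hmain, fun v => ?_⟩
    have hint : Integrable (fun y => f y • fderiv ℝ k (x - y)) (arcLength D) := by
      refine hbi.mono' hF'meas ?_
      filter_upwards [hbound] with y hy using hy x (Metric.mem_ball_self hδ)
    rw [ContinuousLinearMap.integral_apply hint, layer]
    refine integral_congr_ae (Eventually.of_forall fun y => ?_)
    simp [mul_comm]
  · filter_upwards [Metric.ball_mem_nhds x hδ] with z hz
    exact (hD.integrable_layer_kernel hf hk.continuousOn fun y hy => hsub (hmem y hy z hz)).1
  · exact hD.integrable_layer_kernel hf hk.continuousOn hx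
  · filter_upwards [hae] with y hy z hz
    have h1 : HasFDerivAt k (fderiv ℝ k (z - y)) (z - y) :=
      ((hk.contDiffAt (hO.mem_nhds (hsub (hmem y hy z hz)))).differentiableAt one_ne_zero).hasFDerivAt
    have h2 : HasFDerivAt (fun z => k (z - y)) (fderiv ℝ k (z - y)) z := by
      have := h1.comp z ((hasFDerivAt_id z).sub_const y)
      rw [ContinuousLinearMap.comp_id] at this
      exact this
    exact h2.mul_const (f y)

theorem fderiv_layer (hD : IsBoundedC2Domain D) (hf : Integrable f (arcLength D))
    (hO : IsOpen O) (hk : ContDiffOn ℝ 1 k O) {x : Plane} (hx : ∀ y ∈ frontier D, x - y ∈ O)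
    (v : Plane) : fderiv ℝ (layer D f k) x v = layer D f (fun z => fderiv ℝ k z v) x := by
  obtain ⟨L, hL, h⟩ := hD.hasFDerivAt_layer hf hO hk hx
  rw [hL.fderiv, h]

theorem differentiableAt_layer (hD : IsBoundedC2Domain D) (hf : Integrable f (arcLength D))
    (hO : IsOpen O) (hk : ContDiffOn ℝ 1 k O) {x : Plane} (hx : ∀ y ∈ frontier D, x - y ∈ O) :
    DifferentiableAt ℝ (layer D f k) x := by
  obtain ⟨L, hL, h⟩ := hD.hasFDerivAt_layer hf hO hk hx
  exact hL.differentiableAt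

theorem contDiff_layer (hD : IsBoundedC2Domain D) (hf : Integrable f (arcLength D))
    (hk : ContDiff ℝ 2 k) : ContDiff ℝ 1 (layer D f k) := by
  have hk1 : ContDiff ℝ 1 k := hk.of_le (by norm_num)
  rw [contDiff_one_iff_fderiv]
  refine ⟨fun x => hD.differentiableAt_layer hf isOpen_univ hk1.contDiffOn (by simp), ?_⟩
  rw [continuous_clm_apply]
  intro v
  have : (fun x => fderiv ℝ (layer D f k) x v) = layer D f (fun z => fderiv ℝ k z v) :=
    funext fun x => hD.fderiv_layer hf isOpen_univ hk1.contDiffOn (by simp) v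
  rw [this]
  have hkv : ContDiff ℝ 1 fun z => fderiv ℝ k z v :=
    (hk.fderiv_right (m := 1) (by norm_num)).clm_apply contDiff_const
  exact continuous_iff_continuousAt.2 fun x =>
    (hD.differentiableAt_layer hf isOpen_univ hkv.contDiffOn (by simp)).continuousAt

end IsBoundedC2Domain

/-! ### Regularized kernels and Green's identity. -/

/-- The logarithmic kernel with regularization parameter `ε`. -/
noncomputable def logKernel (ε : ℝ) (x : Plane) : ℝ :=
  1 / (4 * Real.pi) * Real.log (‖x‖ ^ 2 + ε ^ 2)

/-- The partial derivatives of the regularized logarithmic kernel. -/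
noncomputable def gradKernel (ε : ℝ) (i : Fin 2) (x : Plane) : ℝ :=
  x i / (2 * Real.pi * (‖x‖ ^ 2 + ε ^ 2))

/-- The Laplacian of the regularized logarithmic kernel. -/
noncomputable def deltaKernel (ε : ℝ) (x : Plane) : ℝ :=
  ε ^ 2 / (Real.pi * (‖x‖ ^ 2 + ε ^ 2) ^ 2)

theorem logKernel_zero : logKernel 0 = fundamentalSolution := by
  funext x
  rw [logKernel, fundamentalSolution]
  simp only [ne_eq, OfNat.ofNat_ne_zero, not_false_eq_true, zero_pow, add_zero, Real.log_pow]
  push_cast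
  have := Real.pi_pos.ne'
  field_simp
  norm_num

theorem contDiffAt_logKernel {ε : ℝ} {x : Plane} (h : ‖x‖ ^ 2 + ε ^ 2 ≠ 0) {n : WithTop ℕ∞} :
    ContDiffAt ℝ n (logKernel ε) x := by
  unfold logKernel
  exact contDiffAt_const.mul (((contDiff_norm_sq ℝ).add contDiff_const).contDiffAt.log h)

theorem contDiff_coord (i : Fin 2) {n : WithTop ℕ∞} : ContDiff ℝ n fun x : Plane => x i :=
  (EuclideanSpace.proj (𝕜 := ℝ) i).contDiff

theorem contDiffAt_gradKernel {ε : ℝ} {x : Plane} (h : ‖x‖ ^ 2 + ε ^ 2 ≠ 0) (i : Fin 2)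
    {n : WithTop ℕ∞} : ContDiffAt ℝ n (gradKernel ε i) x := by
  unfold gradKernel
  refine (contDiff_coord i).contDiffAt.div
    (contDiffAt_const.mul ((contDiff_norm_sq ℝ).add contDiff_const).contDiffAt) ?_
  exact mul_ne_zero (by positivity) h

theorem hasFDerivAt_normSq_add (ε : ℝ) (x : Plane) :
    HasFDerivAt (fun x : Plane => ‖x‖ ^ 2 + ε ^ 2) (2 • innerSL ℝ x) x :=
  (hasStrictFDerivAt_norm_sq x).hasFDerivAt.add_const _

theorem fderiv_logKernel {ε : ℝ} {x : Plane} (h : ‖x‖ ^ 2 + ε ^ 2 ≠ 0) (i : Fin 2) :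
    fderiv ℝ (logKernel ε) x (EuclideanSpace.single i 1) = gradKernel ε i x := by
  have := ((hasFDerivAt_normSq_add ε x).log h).const_mul (1 / (4 * Real.pi))
  unfold logKernel
  rw [this.fderiv, gradKernel]
  simp [EuclideanSpace.inner_single_right]
  have := Real.pi_pos.ne'
  field_simp
  norm_num

/-- In dimension two the terms in `‖x‖ ^ 2` cancel in the sum, leaving only `2 * ε ^ 2` in the
numerator. -/
theorem sum_fderiv_gradKernel {ε : ℝ} {x : Plane} (h : ‖x‖ ^ 2 + ε ^ 2 ≠ 0) :
    ∑ i, fderiv ℝ (gradKernel ε i) x (EuclideanSpace.single i 1) = deltaKernel ε x := by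
  have hpi := Real.pi_pos.ne'
  have hd : ∀ i, fderiv ℝ (gradKernel ε i) x (EuclideanSpace.single i 1) =
      (‖x‖ ^ 2 + ε ^ 2 - 2 * x i ^ 2) / (2 * Real.pi * (‖x‖ ^ 2 + ε ^ 2) ^ 2) := by
    intro i
    have h1 : HasFDerivAt (fun x : Plane => x i) (EuclideanSpace.proj (𝕜 := ℝ) i) x :=
      (EuclideanSpace.proj (𝕜 := ℝ) i).hasFDerivAt
    have h2 := (hasFDerivAt_normSq_add ε x).const_mul (2 * Real.pi)
    have h3 := h1.mul ((hasDerivAt_inv (mul_ne_zero (by positivity) h)).comp_hasFDerivAt x h2)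
    have h4 : gradKernel ε i = (fun x : Plane => x i) *
        (Inv.inv ∘ fun x : Plane => 2 * Real.pi * (‖x‖ ^ 2 + ε ^ 2)) := by
      funext z
      simp [gradKernel, div_eq_mul_inv]
    rw [h4, h3.fderiv]
    simp [EuclideanSpace.inner_single_right]
    field_simp
    ring
  have hn : ‖x‖ ^ 2 = x 0 ^ 2 + x 1 ^ 2 := by
    rw [EuclideanSpace.real_norm_sq_eq, Fin.sum_univ_two]
  rw [Fin.sum_univ_two, hd, hd, deltaKernel]
  field_simp
  rw [hn]
  ring

theorem normSq_add_ne_zero {ε : ℝ} (hε : ε ≠ 0) (x : Plane) : ‖x‖ ^ 2 + ε ^ 2 ≠ 0 := by positivity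

theorem contDiff_logKernel {ε : ℝ} (hε : ε ≠ 0) {n : WithTop ℕ∞} : ContDiff ℝ n (logKernel ε) :=
  contDiff_iff_contDiffAt.2 fun x => contDiffAt_logKernel (normSq_add_ne_zero hε x)

theorem contDiff_gradKernel {ε : ℝ} (hε : ε ≠ 0) (i : Fin 2) {n : WithTop ℕ∞} :
    ContDiff ℝ n (gradKernel ε i) :=
  contDiff_iff_contDiffAt.2 fun x => contDiffAt_gradKernel (normSq_add_ne_zero hε x) i

theorem continuous_deltaKernel {ε : ℝ} (hε : ε ≠ 0) : Continuous (deltaKernel ε) := by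
  unfold deltaKernel
  refine continuous_const.div (by fun_prop) fun x => ?_
  have := normSq_add_ne_zero hε x
  positivity

/-- The kernel of the regularized Neumann–Poincaré operator. -/
noncomputable def normalKernel (D : Set Plane) (ε : ℝ) (x y : Plane) : ℝ :=
  ⟪x - y, outwardNormal D x⟫ / (2 * Real.pi * (‖x - y‖ ^ 2 + ε ^ 2))

namespace IsBoundedC2Domain

variable {D : Set Plane} {f : Plane → ℝ}

theorem isCompact_closure (hD : IsBoundedC2Domain D) : IsCompact (closure D) :=
  Metric.isCompact_of_isClosed_isBounded isClosed_closure hD.isBounded.closure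

theorem integrableOn_of_continuous (hD : IsBoundedC2Domain D) {g : Plane → ℝ}
    (hg : Continuous g) : IntegrableOn g D :=
  (hg.continuousOn.integrableOn_compact hD.isCompact_closure).mono_set subset_closure

theorem continuous_layer_of_contDiff (hD : IsBoundedC2Domain D) (hf : Integrable f (arcLength D))
    {k : Plane → ℝ} (hk : ContDiff ℝ 1 k) : Continuous (layer D f k) :=
  continuous_iff_continuousAt.2 fun x =>
    (hD.differentiableAt_layer hf isOpen_univ hk.contDiffOn (by simp)).continuousAt

theorem contDiff_deltaKernel {ε : ℝ} (hε : ε ≠ 0) {n : WithTop ℕ∞} :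
    ContDiff ℝ n (deltaKernel ε) := by
  unfold deltaKernel
  refine contDiff_const.div (contDiff_const.mul
    (((contDiff_norm_sq ℝ).add contDiff_const).pow 2)) fun x => ?_
  have := normSq_add_ne_zero hε x
  positivity

/-- Identifies the regularized Neumann–Poincaré integral with the normal derivative of the
regularized potential; for `ε ≠ 0` there is no jump term. -/
theorem integral_normalKernel_eq (hD : IsBoundedC2Domain D) (hf : Integrable f (arcLength D))
    {ε : ℝ} (hε : ε ≠ 0) (x : Plane) :
    ∫ y, normalKernel D ε x y * f y ∂(arcLength D) =
      ∑ i, layer D f (gradKernel ε i) x * ⟪EuclideanSpace.single i (1 : ℝ), outwardNormal D x⟫ := by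
  simp_rw [layer, ← integral_mul_const]
  rw [← integral_finsetSum]
  · refine integral_congr_ae (Eventually.of_forall fun y => ?_)
    simp only [normalKernel, gradKernel, Fin.sum_univ_two, PiLp.inner_apply]
    simp
    ring
  · intro i _
    exact (hD.integrable_layer_kernel (O := univ) hf
      (contDiff_gradKernel hε i (n := 0)).continuous.continuousOn (by simp)).mul_const _

/-- Green's identity for the regularized single-layer potential. -/
theorem regularized_green_identity (hD : IsBoundedC2Domain D) (hf : Integrable f (arcLength D))
    {ε : ℝ} (hε : ε ≠ 0) :
    (∫ x in D, ∑ i, layer D f (gradKernel ε i) x ^ 2) +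
      ∫ x in D, layer D f (logKernel ε) x * layer D f (deltaKernel ε) x =
    ∫ x, layer D f (logKernel ε) x * (∫ y, normalKernel D ε x y * f y ∂(arcLength D))
      ∂(arcLength D) := by
  have hu : ContDiff ℝ 1 (layer D f (logKernel ε)) := hD.contDiff_layer hf (contDiff_logKernel hε)
  have hp : ∀ i, ContDiff ℝ 1 (layer D f (gradKernel ε i)) := fun i =>
    hD.contDiff_layer hf (contDiff_gradKernel hε i)
  -- Gauss–Green for each component of the field `u_ε ∇u_ε`; the sum over `i` is the divergence
  -- theorem.
  have hgg := fun i => hD.integral_fderiv_eq (hu.mul (hp i)) (EuclideanSpace.single i 1)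
  have hdu : ∀ i x, fderiv ℝ (layer D f (logKernel ε)) x (EuclideanSpace.single i 1) =
      layer D f (gradKernel ε i) x := by
    intro i x
    rw [hD.fderiv_layer hf isOpen_univ (contDiff_logKernel hε).contDiffOn (by simp)]
    congr 1
    funext z
    exact fderiv_logKernel (normSq_add_ne_zero hε z) i
  have hdp : ∀ x, ∑ i, fderiv ℝ (layer D f (gradKernel ε i)) x (EuclideanSpace.single i 1) =
      layer D f (deltaKernel ε) x := by
    intro x
    have : ∀ i, fderiv ℝ (layer D f (gradKernel ε i)) x (EuclideanSpace.single i 1) =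
        ∫ y, fderiv ℝ (gradKernel ε i) (x - y) (EuclideanSpace.single i 1) * f y
          ∂(arcLength D) := fun i =>
      hD.fderiv_layer hf isOpen_univ (contDiff_gradKernel hε i).contDiffOn (by simp) _
    simp_rw [this]
    rw [← integral_finsetSum, layer]
    · refine integral_congr_ae (Eventually.of_forall fun y => ?_)
      simp only
      rw [← Finset.sum_mul, sum_fderiv_gradKernel (normSq_add_ne_zero hε _)]
    · intro i _
      refine hD.integrable_layer_kernel (O := univ) (k := fun z =>
        fderiv ℝ (gradKernel ε i) z (EuclideanSpace.single i 1)) hf ?_ (by simp)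
      have := (contDiff_gradKernel hε i (n := 1)).continuous_fderiv one_ne_zero
      fun_prop
  have hprod : ∀ i x, fderiv ℝ (fun x => layer D f (logKernel ε) x * layer D f (gradKernel ε i) x) x
      (EuclideanSpace.single i 1) = layer D f (gradKernel ε i) x ^ 2 + layer D f (logKernel ε) x *
        fderiv ℝ (layer D f (gradKernel ε i)) x (EuclideanSpace.single i 1) := by
    intro i x
    rw [fderiv_fun_mul (hu.differentiable one_ne_zero x) ((hp i).differentiable one_ne_zero x)]
    simp [hdu]
    ring
  have hcd : Continuous (layer D f (deltaKernel ε)) :=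
    hD.continuous_layer_of_contDiff hf (contDiff_deltaKernel hε)
  have hi1 : IntegrableOn (fun x => ∑ i, layer D f (gradKernel ε i) x ^ 2) D :=
    hD.integrableOn_of_continuous (continuous_finsetSum _ fun i _ => (hp i).continuous.pow 2)
  have hi2 : IntegrableOn (fun x => layer D f (logKernel ε) x * layer D f (deltaKernel ε) x) D :=
    hD.integrableOn_of_continuous (hu.continuous.mul hcd)
  rw [← integral_add hi1 hi2]
  have hL : ∫ x in D, (∑ i, layer D f (gradKernel ε i) x ^ 2 +
      layer D f (logKernel ε) x * layer D f (deltaKernel ε) x) =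
      ∑ i, ∫ x in D, fderiv ℝ
        (fun x => layer D f (logKernel ε) x * layer D f (gradKernel ε i) x) x
        (EuclideanSpace.single i 1) := by
    rw [← integral_finsetSum]
    · refine integral_congr_ae (Eventually.of_forall fun x => ?_)
      simp only [hprod, Finset.sum_add_distrib, ← Finset.mul_sum, hdp]
    · intro i _
      refine hD.integrableOn_of_continuous ?_
      have := (hu.mul (hp i)).continuous_fderiv one_ne_zero
      fun_prop
  rw [hL]
  simp_rw [hgg]
  rw [← integral_finsetSum]
  · refine integral_congr_ae (Eventually.of_forall fun x => ?_)
    simp only [mul_assoc, ← Finset.mul_sum]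
    rw [hD.integral_normalKernel_eq hf hε]
  · intro i _
    exact hD.integrable_arcLength_of_continuousOn
      ((hu.continuous.mul (hp i).continuous).continuousOn.mul
        (hD.continuousOn_inner_outwardNormal _))

end IsBoundedC2Domain

/-! ### Kernel estimates uniform in the regularization. -/

/-- With `q` the right-hand side, the difference is `log (1 + q ^ 8) / (4π)` in absolute value. It
is at most `8 * q / (4π)` since `1 + q ^ 8 ≤ (1 + q) ^ 8`, and `8 ≤ 4π`. The exponent `1/4` is
chosen so that its square, `1/2`, is still integrable on a curve. -/
theorem abs_logKernel_zero_sub_le {ε : ℝ} (hε : 0 < ε) {z : Plane} (hz : z ≠ 0) :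
    |logKernel 0 z - logKernel ε z| ≤ (ε / ‖z‖) ^ (1 / 4 : ℝ) := by
  have hn : 0 < ‖z‖ := norm_pos_iff.2 hz
  set q := (ε / ‖z‖) ^ (1 / 4 : ℝ) with hq
  have hq0 : 0 ≤ q := by positivity
  have hq8 : q ^ 8 = ε ^ 2 / ‖z‖ ^ 2 := by
    rw [hq, ← Real.rpow_natCast, ← Real.rpow_mul (by positivity)]
    norm_num
    rw [div_pow]
  have h1 : ‖z‖ ^ 2 + ε ^ 2 = ‖z‖ ^ 2 * (1 + q ^ 8) := by
    rw [hq8]; field_simp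
  have h2 : logKernel 0 z - logKernel ε z = -(1 / (4 * Real.pi) * Real.log (1 + q ^ 8)) := by
    rw [logKernel, logKernel, h1, Real.log_mul (by positivity) (by positivity)]
    simp
    ring
  have h3 : Real.log (1 + q ^ 8) ≤ 8 * q := by
    have : 1 + q ^ 8 ≤ (1 + q) ^ 8 := by
      have := pow_add_pow_le zero_le_one hq0 (n := 8) (by norm_num)
      simpa using this
    calc Real.log (1 + q ^ 8) ≤ Real.log ((1 + q) ^ 8) := Real.log_le_log (by positivity) this
      _ = 8 * Real.log (1 + q) := by rw [Real.log_pow]; norm_num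
      _ ≤ 8 * q := by
        have := Real.log_le_sub_one_of_pos (show 0 < 1 + q by positivity)
        linarith
  have h4 : 0 ≤ Real.log (1 + q ^ 8) := Real.log_nonneg (by have := pow_nonneg hq0 8; linarith)
  rw [h2, abs_neg, abs_of_nonneg (by positivity), one_div, inv_mul_eq_div,
    div_le_iff₀ (by positivity)]
  nlinarith [Real.pi_gt_three]

theorem sq_rpow_quarter {r : ℝ} (hr : 0 ≤ r) : (r ^ (1 / 4 : ℝ)) ^ 2 = r ^ (1 / 2 : ℝ) := by
  rw [← Real.rpow_natCast, ← Real.rpow_mul hr]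
  norm_num

/-- Young's inequality separates the singularity from the density: for `c = f y` with `f` in L²,
both terms are integrable on the boundary. -/
theorem abs_logKernel_zero_sub_mul_le {ε : ℝ} (hε : 0 < ε) {z : Plane} (hz : z ≠ 0) (c : ℝ) :
    |(logKernel 0 z - logKernel ε z) * c| ≤
      ε ^ (1 / 4 : ℝ) * (‖z‖ ^ (-(1 / 2) : ℝ) + c ^ 2) := by
  have hn : 0 < ‖z‖ := norm_pos_iff.2 hz
  have h := abs_logKernel_zero_sub_le hε hz
  rw [Real.div_rpow hε.le hn.le] at h
  have hb : ‖z‖ ^ (-(1 / 2) : ℝ) = ((‖z‖ ^ (1 / 4 : ℝ))⁻¹) ^ 2 := by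
    rw [Real.rpow_neg hn.le, inv_pow, sq_rpow_quarter hn.le]
  rw [hb, abs_mul]
  have ha : 0 < ε ^ (1 / 4 : ℝ) := by positivity
  set a := ε ^ (1 / 4 : ℝ)
  set b := (‖z‖ ^ (1 / 4 : ℝ))⁻¹
  have hb0 : 0 ≤ b := by positivity
  calc |logKernel 0 z - logKernel ε z| * |c| ≤ (a * b) * |c| :=
        mul_le_mul_of_nonneg_right h (abs_nonneg c)
    _ = a * (b * |c|) := by ring
    _ ≤ a * (b ^ 2 + c ^ 2) := by
        refine mul_le_mul_of_nonneg_left ?_ ha.le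
        nlinarith [sq_nonneg (b - |c|), sq_abs c, sq_nonneg b, sq_nonneg c]

/-- Up to a factor at most one, the inner product is the deviation of the graph from its tangent at
`x`. A bound on the second derivative of `γ` makes this quadratic, by applying the mean value
inequality to `deriv γ` and then to `γ τ - deriv γ s * τ`. This is where C² regularity is needed. -/
theorem IsGraphChart.exists_abs_inner_le {D : Set Plane} {p : Plane} {e : Plane ≃ₗᵢ[ℝ] Plane}
    {γ : ℝ → ℝ} {r : ℝ} (h : IsGraphChart D p e γ r) (ho : IsOpen D) :
    ∃ B : ℝ, 0 ≤ B ∧ ∀ x ∈ frontier D, ∀ y ∈ frontier D, x ∈ Metric.ball p r →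
      y ∈ Metric.ball p r → |⟪x - y, outwardNormal D x⟫| ≤ B * ‖x - y‖ ^ 2 := by
  have hd1 : ContDiff ℝ 1 (deriv γ) := (contDiff_succ_iff_deriv.1 h.contDiff).2.2
  obtain ⟨M, hM⟩ := (isCompact_Icc (a := e p 0 - r) (b := e p 0 + r)).exists_bound_of_continuousOn
    (hd1.continuous_deriv le_rfl).continuousOn
  have hM0 : 0 ≤ M := (norm_nonneg _).trans (hM (e p 0) ⟨by linarith [h.pos], by linarith [h.pos]⟩)
  refine ⟨M, hM0, fun x hx y hy hxb hyb => ?_⟩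
  have hI : ∀ z ∈ Metric.ball p r, e z 0 ∈ Icc (e p 0 - r) (e p 0 + r) := by
    intro z hz
    have h1 := (abs_coord_sub_le_dist e _ _).trans_lt (Metric.mem_ball.1 hz)
    rw [abs_lt] at h1
    constructor <;> linarith [h1.1, h1.2]
  set s := e x 0 with hs
  set t := e y 0 with ht
  have hseg : uIcc s t ⊆ Icc (e p 0 - r) (e p 0 + r) := uIcc_subset_Icc (hI x hxb) (hI y hyb)
  have hder : ∀ τ ∈ uIcc s t, |deriv γ τ - deriv γ s| ≤ M * |s - t| := by
    intro τ hτ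
    have := (convex_Icc (e p 0 - r) (e p 0 + r)).norm_image_sub_le_of_norm_deriv_le
      (fun z _ => hd1.differentiable one_ne_zero z) hM (hI x hxb) (hseg hτ)
    refine this.trans (mul_le_mul_of_nonneg_left ?_ hM0)
    rw [Real.norm_eq_abs, abs_sub_comm]
    have := abs_sub_left_of_mem_uIcc hτ
    rwa [abs_sub_comm, abs_sub_comm t] at this
  have hγd : Differentiable ℝ γ := h.contDiff.differentiable (by norm_num)
  have hmv := (convex_uIcc s t).norm_image_sub_le_of_norm_deriv_le (𝕜 := ℝ)
    (f := fun τ => γ τ - deriv γ s * τ) (C := M * |s - t|)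
    (fun z _ => (hγd z).sub ((differentiableAt_id).const_mul _)) (fun z hz => by
      have hz' := (hγd z).hasDerivAt.sub ((hasDerivAt_id z).const_mul (deriv γ s))
      rw [mul_one] at hz'
      exact (congrArg norm hz'.deriv).trans_le (hder z hz)) right_mem_uIcc left_mem_uIcc
  rw [h.outwardNormal_eq ho hxb hx, inner_graphNormal, abs_mul,
    abs_of_pos (inv_pos.2 (graphSpeed_pos γ _))]
  have hxv := h.eq_of_mem_frontier ho hxb hx
  have hyv := h.eq_of_mem_frontier ho hyb hy
  have hsub : ∀ i, e (x - y) i = e x i - e y i := fun i => by simp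
  rw [hsub, hsub, hxv, hyv]
  have h1 : |deriv γ s * (s - t) - (γ s - γ t)| ≤ M * |s - t| * |s - t| := by
    rw [abs_sub_comm]
    refine le_trans (le_of_eq ?_) hmv
    rw [Real.norm_eq_abs]
    congr 1
    ring
  have h2 : |s - t| ≤ ‖x - y‖ := by rw [← dist_eq_norm]; exact abs_coord_sub_le_dist e x y
  calc (graphSpeed γ s)⁻¹ * |deriv γ s * (s - t) - (γ s - γ t)|
      ≤ 1 * |deriv γ s * (s - t) - (γ s - γ t)| :=
        mul_le_mul_of_nonneg_right (inv_le_one_of_one_le₀ (one_le_graphSpeed γ s)) (abs_nonneg _)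
    _ ≤ M * |s - t| * |s - t| := by rw [one_mul]; exact h1
    _ ≤ M * ‖x - y‖ * ‖x - y‖ := by gcongr
    _ = M * ‖x - y‖ ^ 2 := by ring

namespace IsBoundedC2Domain

variable {D : Set Plane} {f : Plane → ℝ}

theorem ae_mem_frontier (D : Set Plane) : ∀ᵐ y ∂(arcLength D), y ∈ frontier D :=
  ae_restrict_mem isClosed_frontier.measurableSet

theorem ae_ne_arcLength (D : Set Plane) (x : Plane) : ∀ᵐ y ∂(arcLength D), y ≠ x := by
  have : Measure.hausdorffMeasure 1 ({x} : Set Plane) = 0 :=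
    (Measure.nullSingletonClass_hausdorff Plane one_pos).measure_singleton x
  exact ae_restrict_of_ae (measure_eq_zero_iff_ae_notMem.1 this)

theorem exists_integral_rpow_neg_half_le (hD : IsBoundedC2Domain D) :
    ∃ C : ℝ, ∀ x : Plane, Integrable (fun y => ‖x - y‖ ^ (-(1 / 2) : ℝ)) (arcLength D) ∧
      ∫ y, ‖x - y‖ ^ (-(1 / 2) : ℝ) ∂(arcLength D) ≤ C := by
  obtain ⟨C, hC⟩ := hD.exists_lintegral_rpow_neg_half_le
  refine ⟨C, fun x => ?_⟩
  have hle : ∫⁻ y, ENNReal.ofReal (‖x - y‖ ^ (-(1 / 2) : ℝ)) ∂(arcLength D) ≤ C := by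
    refine le_trans (lintegral_mono_ae ?_) (hC x)
    filter_upwards [ae_ne_arcLength D x] with y hy
    rw [← ENNReal.ofReal_rpow_of_pos (norm_pos_iff.2 (sub_ne_zero.2 hy.symm)), ofReal_norm]
  have hm : AEStronglyMeasurable (fun y => ‖x - y‖ ^ (-(1 / 2) : ℝ)) (arcLength D) :=
    (by fun_prop : Measurable fun y : Plane => ‖x - y‖ ^ (-(1 / 2) : ℝ)).aestronglyMeasurable
  have h0 : 0 ≤ᵐ[arcLength D] fun y => ‖x - y‖ ^ (-(1 / 2) : ℝ) :=
    Eventually.of_forall fun y => by positivity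
  refine ⟨⟨hm, ?_⟩, ?_⟩
  · rw [hasFiniteIntegral_iff_ofReal h0]
    exact hle.trans_lt ENNReal.coe_lt_top
  · rw [integral_eq_lintegral_of_nonneg_ae h0 hm]
    exact ENNReal.toReal_le_coe_of_le_coe hle

theorem integrable_of_memLp (hD : IsBoundedC2Domain D) (hf : MemLp f 2 (arcLength D)) :
    Integrable f (arcLength D) := by
  have := hD.isFiniteMeasure_arcLength
  exact hf.integrable (by norm_num)

/-- The regularized single-layer potentials converge uniformly in the plane. -/
theorem exists_abs_layer_logKernel_sub_le (hD : IsBoundedC2Domain D)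
    (hf : MemLp f 2 (arcLength D)) :
    ∃ A : ℝ, 0 ≤ A ∧ ∀ x : Plane, Integrable (fun y => logKernel 0 (x - y) * f y) (arcLength D) ∧
      ∀ ε : ℝ, 0 < ε →
        |layer D f (logKernel 0) x - layer D f (logKernel ε) x| ≤ A * ε ^ (1 / 4 : ℝ) := by
  obtain ⟨C, hC⟩ := hD.exists_integral_rpow_neg_half_le
  have hf1 := hD.integrable_of_memLp hf
  have hf2 : Integrable (fun y => f y ^ 2) (arcLength D) := hf.integrable_sq
  have hC0 : 0 ≤ C := (integral_nonneg fun y => by positivity).trans (hC 0).2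
  have hA : 0 ≤ C + ∫ y, f y ^ 2 ∂(arcLength D) :=
    add_nonneg hC0 (integral_nonneg fun y => sq_nonneg _)
  refine ⟨C + ∫ y, f y ^ 2 ∂(arcLength D), hA, fun x => ?_⟩
  have hbd : ∀ ε : ℝ, 0 < ε → ∀ᵐ y ∂(arcLength D),
      ‖(logKernel 0 (x - y) - logKernel ε (x - y)) * f y‖ ≤
        ε ^ (1 / 4 : ℝ) * (‖x - y‖ ^ (-(1 / 2) : ℝ) + f y ^ 2) := by
    intro ε hε
    filter_upwards [ae_ne_arcLength D x] with y hy
    exact abs_logKernel_zero_sub_mul_le hε (sub_ne_zero.2 hy.symm) _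
  have hbi : ∀ ε : ℝ, Integrable
      (fun y => ε ^ (1 / 4 : ℝ) * (‖x - y‖ ^ (-(1 / 2) : ℝ) + f y ^ 2)) (arcLength D) := fun ε =>
    ((hC x).1.add hf2).const_mul _
  have hmeas : ∀ ε : ℝ, AEStronglyMeasurable (fun y => logKernel ε (x - y)) (arcLength D) := by
    intro ε
    refine Measurable.aestronglyMeasurable ?_
    unfold logKernel
    fun_prop
  have hdi : ∀ ε : ℝ, 0 < ε →
      Integrable (fun y => (logKernel 0 (x - y) - logKernel ε (x - y)) * f y) (arcLength D) :=
    fun ε hε => (hbi ε).mono' (((hmeas 0).sub (hmeas ε)).mul hf1.1) (hbd ε hε)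
  have hεi : ∀ ε : ℝ, 0 < ε →
      Integrable (fun y => logKernel ε (x - y) * f y) (arcLength D) := fun ε hε =>
    hD.integrable_layer_kernel (O := univ) hf1
      (contDiff_logKernel hε.ne' (n := 0)).continuous.continuousOn (by simp)
  have h0 : Integrable (fun y => logKernel 0 (x - y) * f y) (arcLength D) := by
    refine ((hdi 1 one_pos).add (hεi 1 one_pos)).congr (Eventually.of_forall fun y => ?_)
    simp only [Pi.add_apply]
    ring
  refine ⟨h0, fun ε hε => ?_⟩
  rw [layer, layer, ← integral_sub h0 (hεi ε hε)]
  simp_rw [← sub_mul]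
  refine (norm_integral_le_of_norm_le (hbi ε) (hbd ε hε)).trans ?_
  rw [integral_const_mul, integral_add (hC x).1 hf2, mul_comm]
  exact mul_le_mul_of_nonneg_right (by linarith [(hC x).2]) (by positivity)

/-- For `‖x - y‖ < r p / 2` both points lie in one chart and the quadratic estimate applies.
Otherwise Cauchy–Schwarz suffices, as `‖x - y‖ ≤ (2 / r p) * ‖x - y‖ ^ 2`. Adding `ε ^ 2` only
enlarges the denominator, so the bound is uniform in `ε`, with `ε = 0` included. -/
theorem exists_abs_normalKernel_le (hD : IsBoundedC2Domain D) :
    ∃ B : ℝ, ∀ ε : ℝ, ∀ x ∈ frontier D, ∀ y ∈ frontier D, |normalKernel D ε x y| ≤ B := by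
  obtain ⟨T, e, γ, r, hT, hcov⟩ := hD.exists_finite_cover (1 / 2) (by norm_num)
  have : ∀ p, ∃ B : ℝ, 0 ≤ B ∧ (p ∈ T → ∀ x ∈ frontier D, ∀ y ∈ frontier D,
      x ∈ Metric.ball p (1 / 2 * r p) → |⟪x - y, outwardNormal D x⟫| ≤ B * ‖x - y‖ ^ 2) := by
    intro p
    by_cases hp : p ∈ T
    · have hr := (hT p hp).2.pos
      obtain ⟨B, hB, h⟩ := (hT p hp).2.exists_abs_inner_le hD.isOpen
      refine ⟨B + 2 / r p, by positivity, fun _ x hx y hy hxb => ?_⟩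
      have hxr : x ∈ Metric.ball p (r p) := Metric.ball_subset_ball (by linarith) hxb
      by_cases hxy : ‖x - y‖ < r p / 2
      · have hyr : y ∈ Metric.ball p (r p) := by
          rw [Metric.mem_ball] at hxb ⊢
          have := dist_triangle y x p
          rw [dist_comm y x, dist_eq_norm x y] at this
          linarith
        refine (h x hx y hy hxr hyr).trans ?_
        have : 0 ≤ 2 / r p := by positivity
        nlinarith [sq_nonneg ‖x - y‖]
      · rw [not_lt] at hxy
        have h1 := abs_real_inner_le_norm (x - y) (outwardNormal D x)
        rw [(hD.isOutwardUnitNormal hx).1, mul_one] at h1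
        refine h1.trans ?_
        have h2 : 1 ≤ 2 / r p * ‖x - y‖ := by
          rw [div_mul_eq_mul_div, le_div_iff₀ hr]; linarith
        nlinarith [norm_nonneg (x - y), mul_nonneg hB (sq_nonneg ‖x - y‖)]
    · exact ⟨0, le_rfl, fun h => absurd h hp⟩
  choose B hB0 hB using this
  refine ⟨∑ p ∈ T, B p, fun ε x hx y hy => ?_⟩
  obtain ⟨p, hp, hxp⟩ := mem_iUnion₂.1 (hcov hx)
  have hle : B p ≤ ∑ p ∈ T, B p := Finset.single_le_sum (fun p _ => hB0 p) hp
  have h := hB p hp x hx y hy hxp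
  rw [normalKernel, abs_div, abs_of_nonneg (by positivity : 0 ≤ 2 * Real.pi * (‖x - y‖ ^ 2 + ε ^ 2))]
  refine div_le_of_le_mul₀ (by positivity) ((hB0 p).trans hle) (h.trans ?_)
  have h3 : ‖x - y‖ ^ 2 ≤ 2 * Real.pi * (‖x - y‖ ^ 2 + ε ^ 2) := by
    nlinarith [Real.pi_gt_three, sq_nonneg ‖x - y‖, sq_nonneg ε]
  exact mul_le_mul hle h3 (sq_nonneg _) ((hB0 p).trans hle)

theorem tendsto_normalKernel {D : Set Plane} {x y : Plane} (hxy : y ≠ x) {ε : ℕ → ℝ}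
    (hε : Tendsto ε atTop (𝓝 0)) :
    Tendsto (fun n => normalKernel D (ε n) x y) atTop (𝓝 (normalKernel D 0 x y)) := by
  have hpos : 0 < ‖x - y‖ := norm_pos_iff.2 (sub_ne_zero.2 hxy.symm)
  have hc : ContinuousAt (fun ε : ℝ => normalKernel D ε x y) 0 := by
    unfold normalKernel
    refine continuousAt_const.div (by fun_prop) ?_
    positivity
  exact hc.tendsto.comp hε

theorem tendsto_integral_normalKernel (hD : IsBoundedC2Domain D) (hf : Integrable f (arcLength D))
    {x : Plane} (hx : x ∈ frontier D) {ε : ℕ → ℝ} (hε : Tendsto ε atTop (𝓝 0)) :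
    Tendsto (fun n => ∫ y, normalKernel D (ε n) x y * f y ∂(arcLength D)) atTop
      (𝓝 (∫ y, normalKernel D 0 x y * f y ∂(arcLength D))) := by
  obtain ⟨B, hB⟩ := hD.exists_abs_normalKernel_le
  refine tendsto_integral_of_dominated_convergence (fun y => B * |f y|) (fun n => ?_)
    (hf.abs.const_mul B) (fun n => ?_) ?_
  · refine AEStronglyMeasurable.mul (Measurable.aestronglyMeasurable ?_) hf.1
    unfold normalKernel
    fun_prop
  · filter_upwards [ae_mem_frontier D] with y hy
    rw [norm_mul]
    exact mul_le_mul_of_nonneg_right (hB _ x hx y hy) (norm_nonneg _)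
  · filter_upwards [ae_ne_arcLength D x] with y hy
    exact (tendsto_normalKernel hy hε).mul_const _

end IsBoundedC2Domain

/-! ### The approximate identity and its half mass at the boundary. -/

theorem deltaKernel_nonneg (ε : ℝ) (x : Plane) : 0 ≤ deltaKernel ε x := by
  unfold deltaKernel
  positivity

theorem deltaKernel_neg (ε : ℝ) (x : Plane) : deltaKernel ε (-x) = deltaKernel ε x := by
  simp [deltaKernel]

theorem deltaKernel_smul {ε : ℝ} (hε : 0 < ε) (z : Plane) :
    deltaKernel ε (ε • z) = (ε ^ 2)⁻¹ * deltaKernel 1 z := by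
  have : ‖z‖ ^ 2 + 1 ≠ 0 := by positivity
  have := Real.pi_pos.ne'
  rw [deltaKernel, deltaKernel, norm_smul, Real.norm_of_nonneg hε.le,
    show (ε * ‖z‖) ^ 2 + ε ^ 2 = ε ^ 2 * (‖z‖ ^ 2 + 1) by ring, one_pow]
  field_simp

theorem deltaKernel_le {ε : ℝ} (hε : ε ≠ 0) (x : Plane) :
    deltaKernel ε x ≤ 1 / (Real.pi * ε ^ 2) := by
  have hpi := Real.pi_pos
  have h0 := normSq_add_ne_zero hε x
  unfold deltaKernel
  rw [div_le_div_iff₀ (by positivity) (by positivity)]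
  have h1 : (ε ^ 2) ^ 2 ≤ (‖x‖ ^ 2 + ε ^ 2) ^ 2 :=
    pow_le_pow_left₀ (sq_nonneg ε) (by linarith [sq_nonneg ‖x‖]) 2
  nlinarith

/-- Polar coordinates reduce this to a radial integral with primitive `-1 / (2π (r² + 1))`. -/
theorem integral_deltaKernel_one : ∫ x, deltaKernel 1 x = 1 := by
  have hpi := Real.pi_pos
  have h1 := integral_fun_norm_addHaar (volume : Measure Plane)
    (fun r : ℝ => 1 / (Real.pi * (r ^ 2 + 1) ^ 2))
  have hder : ∀ r ∈ Ici (0 : ℝ), HasDerivAt (fun r : ℝ => -(1 / (2 * Real.pi)) * (r ^ 2 + 1)⁻¹)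
      (r * (1 / (Real.pi * (r ^ 2 + 1) ^ 2))) r := by
    intro r _
    have hne : r ^ 2 + 1 ≠ 0 := by positivity
    have h2 : HasDerivAt (fun r : ℝ => r ^ 2 + 1) (2 * r) r := by
      simpa using (hasDerivAt_pow 2 r).add_const 1
    refine ((h2.fun_inv hne).const_mul (-(1 / (2 * Real.pi)))).congr_deriv ?_
    field_simp
  have hlim : Tendsto (fun r : ℝ => -(1 / (2 * Real.pi)) * (r ^ 2 + 1)⁻¹) atTop (𝓝 0) := by
    have : Tendsto (fun r : ℝ => r ^ 2 + 1) atTop atTop :=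
      tendsto_atTop_add_const_right _ _ (tendsto_pow_atTop two_ne_zero)
    simpa using (tendsto_inv_atTop_zero.comp this).const_mul (-(1 / (2 * Real.pi)))
  have h3 := integral_Ioi_of_hasDerivAt_of_nonneg' hder
    (fun r hr => by have : (0 : ℝ) < r := hr; positivity) hlim
  have hfin : Module.finrank ℝ Plane = 2 := by simp
  have hvol : (volume : Measure Plane).real (Metric.ball 0 1) = Real.pi := by
    rw [measureReal_def, EuclideanSpace.volume_ball_fin_two]
    simp [hpi.le]
  have h4 : ∀ x : Plane, deltaKernel 1 x = 1 / (Real.pi * (‖x‖ ^ 2 + 1) ^ 2) := fun x => by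
    simp [deltaKernel]
  simp_rw [h4]
  rw [h1, hfin, hvol]
  simp only [Nat.add_one_sub_one, pow_one, smul_eq_mul, nsmul_eq_mul]
  rw [h3]
  push_cast
  field_simp
  norm_num

theorem integrable_deltaKernel_one : Integrable (deltaKernel 1) := by
  -- The integral of a non-integrable function is zero by convention, contradicting the value one.
  by_contra h
  have := integral_undef h
  rw [integral_deltaKernel_one] at this
  exact one_ne_zero this

theorem ae_inner_ne_zero {n : Plane} (hn : n ≠ 0) : ∀ᵐ z : Plane, ⟪n, z⟫ ≠ 0 := by
  have h := Measure.addHaar_submodule (volume : Measure Plane)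
    (LinearMap.ker (innerSL ℝ n).toLinearMap) (fun htop => by
      have : n ∈ LinearMap.ker (innerSL ℝ n).toLinearMap := htop ▸ Submodule.mem_top
      simp at this
      exact hn this)
  exact measure_eq_zero_iff_ae_notMem.1 h

/-- The kernel is even and the line separating the two half-planes is null, so each half carries
half of the total mass. -/
theorem setIntegral_deltaKernel_halfSpace {n : Plane} (hn : n ≠ 0) :
    ∫ z in {z : Plane | ⟪n, z⟫ < 0}, deltaKernel 1 z = 1 / 2 := by
  have hm1 : MeasurableSet {z : Plane | ⟪n, z⟫ < 0} :=
    (isOpen_lt (by fun_prop) continuous_const).measurableSet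
  have hm2 : MeasurableSet {z : Plane | 0 < ⟪n, z⟫} :=
    (isOpen_lt continuous_const (by fun_prop)).measurableSet
  have hsym : ∫ z in {z : Plane | 0 < ⟪n, z⟫}, deltaKernel 1 z =
      ∫ z in {z : Plane | ⟪n, z⟫ < 0}, deltaKernel 1 z := by
    have := (Measure.measurePreserving_neg (volume : Measure Plane)).setIntegral_preimage_emb
      (MeasurableEquiv.neg Plane).measurableEmbedding (deltaKernel 1) {z : Plane | ⟪n, z⟫ < 0}
    simp only [deltaKernel_neg] at this
    rw [← this]
    congr 2
    ext z
    simp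
  have hun : ∫ z in {z : Plane | ⟪n, z⟫ < 0} ∪ {z : Plane | 0 < ⟪n, z⟫}, deltaKernel 1 z = 1 := by
    have hU : ({z : Plane | ⟪n, z⟫ < 0} ∪ {z : Plane | 0 < ⟪n, z⟫} : Set Plane) =ᵐ[volume] univ := by
      refine eventuallyEq_univ.2 ?_
      filter_upwards [ae_inner_ne_zero hn] with z hz using lt_or_gt_of_ne hz
    rw [setIntegral_congr_set hU, setIntegral_univ, integral_deltaKernel_one]
  rw [setIntegral_union _ hm2 integrable_deltaKernel_one.integrableOn
    integrable_deltaKernel_one.integrableOn, hsym] at hun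
  · linarith
  · refine Set.disjoint_left.2 fun z h1 h2 => ?_
    exact lt_asymm (show ⟪n, z⟫ < 0 from h1) h2

/-- The substitution `x = y + ε • z` moves all dependence on `ε` from the kernel into the point of
evaluation, ready for dominated convergence. -/
theorem setIntegral_mul_deltaKernel {D : Set Plane} (hD : MeasurableSet D) (g : Plane → ℝ)
    {ε : ℝ} (hε : 0 < ε) (y : Plane) :
    ∫ x in D, g x * deltaKernel ε (x - y) =
      ∫ z, D.indicator g (y + ε • z) * deltaKernel 1 z := by
  have h1 : ∀ z, D.indicator g (y + ε • z) * deltaKernel 1 z =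
      ε ^ 2 * (fun w => D.indicator g (y + w) * deltaKernel ε w) (ε • z) := by
    intro z
    simp only [deltaKernel_smul hε]
    field_simp
  have h2 := Measure.integral_comp_smul (volume : Measure Plane)
    (fun w => D.indicator g (y + w) * deltaKernel ε w) ε
  rw [integral_congr_ae (Eventually.of_forall h1), integral_const_mul, h2,
    ← integral_add_right_eq_self (fun w => D.indicator g (y + w) * deltaKernel ε w) (-y)]
  simp only [← sub_eq_add_neg, add_sub_cancel]
  rw [← integral_indicator hD]
  have hfin : Module.finrank ℝ Plane = 2 := by simp
  rw [hfin, abs_of_pos (by positivity), smul_eq_mul, ← mul_assoc, mul_inv_cancel₀ (by positivity),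
    one_mul]
  congr 1
  funext x
  by_cases hx : x ∈ D <;> simp [hx]

namespace IsBoundedC2Domain

variable {D : Set Plane} {f : Plane → ℝ}

/-- An approximate identity centred at a boundary point sees half of the mass. -/
theorem tendsto_setIntegral_mul_deltaKernel (hD : IsBoundedC2Domain D) {y : Plane}
    (hy : y ∈ frontier D) {ε : ℕ → ℝ} (hpos : ∀ n, 0 < ε n) (hε : Tendsto ε atTop (𝓝 0))
    {g : ℕ → Plane → ℝ} (hg : ∀ n, Continuous (g n)) {U c : ℝ}
    (hU : ∀ n, ∀ x ∈ D, |g n x| ≤ U)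
    (hc : ∀ z : Plane, Tendsto (fun n => g n (y + ε n • z)) atTop (𝓝 c)) :
    Tendsto (fun n => ∫ x in D, g n x * deltaKernel (ε n) (x - y)) atTop (𝓝 (c / 2)) := by
  have hn := hD.isOutwardUnitNormal hy
  set ν := outwardNormal D y
  have hν : ν ≠ 0 := fun h => by have := hn.1; simp [h] at this
  have hεw : Tendsto ε atTop (𝓝[>] 0) :=
    tendsto_nhdsWithin_iff.2 ⟨hε, Eventually.of_forall hpos⟩
  have hm1 : MeasurableSet {z : Plane | ⟪ν, z⟫ < 0} :=
    (isOpen_lt (by fun_prop) continuous_const).measurableSet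
  have hlim : c / 2 = ∫ z, {z : Plane | ⟪ν, z⟫ < 0}.indicator (fun _ => c) z * deltaKernel 1 z := by
    rw [div_eq_mul_one_div, ← setIntegral_deltaKernel_halfSpace hν, ← integral_const_mul,
      ← integral_indicator hm1]
    congr 1
    funext z
    by_cases hz : ⟪ν, z⟫ < 0 <;> simp [indicator, hz]
  simp_rw [setIntegral_mul_deltaKernel hD.isOpen.measurableSet _ (hpos _)]
  rw [hlim]
  refine tendsto_integral_of_dominated_convergence (fun z => |U| * deltaKernel 1 z) (fun n => ?_)
    (integrable_deltaKernel_one.const_mul _) (fun n => Eventually.of_forall fun z => ?_) ?_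
  · refine AEStronglyMeasurable.mul ?_ integrable_deltaKernel_one.1
    exact (((hg n).measurable.indicator hD.isOpen.measurableSet).comp
      (by fun_prop : Measurable fun z : Plane => y + ε n • z)).aestronglyMeasurable
  · rw [norm_mul, Real.norm_of_nonneg (deltaKernel_nonneg 1 z)]
    refine mul_le_mul_of_nonneg_right ?_ (deltaKernel_nonneg 1 z)
    by_cases hz : y + ε n • z ∈ D
    · rw [indicator_of_mem hz]
      exact (hU n _ hz).trans (le_abs_self U)
    · rw [indicator_of_notMem hz]
      simp
  · filter_upwards [ae_inner_ne_zero hν] with z hz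
    refine Tendsto.mul_const _ ?_
    -- The definition of the outward normal by rays says exactly that `y + ε • z` lies eventually in
    -- `D` or eventually outside it, according to the sign of `⟪ν, z⟫`.
    rcases lt_or_gt_of_ne hz with h | h
    · have hin : z ∈ {z : Plane | ⟪ν, z⟫ < 0} := h
      rw [indicator_of_mem hin]
      refine (hc z).congr' ?_
      filter_upwards [hεw.eventually (hn.2.1 z h)] with n hn'
      rw [indicator_of_mem hn']
    · have hin : z ∉ {z : Plane | ⟪ν, z⟫ < 0} := fun h' => lt_asymm (show ⟪ν, z⟫ < 0 from h') h
      rw [indicator_of_notMem hin]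
      refine tendsto_const_nhds.congr' ?_
      filter_upwards [hεw.eventually (hn.2.2 z h)] with n hn'
      rw [indicator_of_notMem fun h' => hn' (subset_closure h')]

/-- Uniform limit of the regularized potentials, hence continuous across the boundary as well. -/
theorem continuous_layer_logKernel_zero (hD : IsBoundedC2Domain D) (hf : MemLp f 2 (arcLength D)) :
    Continuous (layer D f (logKernel 0)) := by
  obtain ⟨A, hA0, hA⟩ := hD.exists_abs_layer_logKernel_sub_le hf
  have hlim : Tendsto (fun ε : ℝ => A * ε ^ (1 / 4 : ℝ)) (𝓝[>] 0) (𝓝 0) := by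
    have : ContinuousAt (fun ε : ℝ => A * ε ^ (1 / 4 : ℝ)) 0 :=
      continuousAt_const.mul (Real.continuousAt_rpow_const _ _ (Or.inr (by norm_num)))
    have := this.tendsto
    simp only [one_div, ne_eq, inv_eq_zero, OfNat.ofNat_ne_zero, not_false_eq_true,
      Real.zero_rpow, mul_zero] at this ⊢
    exact this.mono_left nhdsWithin_le_nhds
  have hunif : TendstoUniformly (fun ε : ℝ => layer D f (logKernel ε)) (layer D f (logKernel 0))
      (𝓝[>] 0) := by
    rw [Metric.tendstoUniformly_iff]
    intro δ hδ
    filter_upwards [hlim.eventually (gt_mem_nhds hδ), self_mem_nhdsWithin] with ε h1 h2 x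
    exact ((hA x).2 ε h2).trans_lt h1
  refine hunif.continuous (Eventually.frequently ?_)
  filter_upwards [self_mem_nhdsWithin] with ε hε
  exact hD.continuous_layer_of_contDiff (hD.integrable_of_memLp hf)
    (contDiff_logKernel (ne_of_gt hε))

end IsBoundedC2Domain

/-! ### Passing to the limit in Green's identity. -/

namespace IsBoundedC2Domain

variable {D : Set Plane} {f : Plane → ℝ}

theorem exists_abs_layer_logKernel_le (hD : IsBoundedC2Domain D) (hf : MemLp f 2 (arcLength D)) :
    ∃ U : ℝ, ∀ ε : ℝ, 0 < ε → ε ≤ 1 → ∀ x ∈ closure D, |layer D f (logKernel ε) x| ≤ U := by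
  obtain ⟨A, hA0, hA⟩ := hD.exists_abs_layer_logKernel_sub_le hf
  obtain ⟨V, hV⟩ := hD.isCompact_closure.exists_bound_of_continuousOn
    (hD.continuous_layer_logKernel_zero hf).continuousOn
  refine ⟨V + A, fun ε h0 h1 x hx => ?_⟩
  have h2 := (hA x).2 ε h0
  have h3 : A * ε ^ (1 / 4 : ℝ) ≤ A :=
    mul_le_of_le_one_right hA0 (Real.rpow_le_one h0.le h1 (by norm_num))
  have h4 := hV x hx
  rw [Real.norm_eq_abs] at h4
  rw [abs_le] at h2 h4 ⊢
  constructor <;> linarith [h2.1, h2.2, h4.1, h4.2]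

/-- Uniform convergence and continuity of the limit allow the evaluation point to move with `n`, as
the rescaled approximate identity requires. -/
theorem tendsto_layer_logKernel (hD : IsBoundedC2Domain D) (hf : MemLp f 2 (arcLength D))
    {ε : ℕ → ℝ} (hpos : ∀ n, 0 < ε n) (hε : Tendsto ε atTop (𝓝 0)) (y z : Plane) :
    Tendsto (fun n => layer D f (logKernel (ε n)) (y + ε n • z)) atTop
      (𝓝 (layer D f (logKernel 0) y)) := by
  obtain ⟨A, hA0, hA⟩ := hD.exists_abs_layer_logKernel_sub_le hf
  have h1 : Tendsto (fun n => layer D f (logKernel 0) (y + ε n • z)) atTop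
      (𝓝 (layer D f (logKernel 0) y)) := by
    have : Tendsto (fun n => y + ε n • z) atTop (𝓝 y) := by
      simpa using (hε.smul_const z).const_add y
    exact ((hD.continuous_layer_logKernel_zero hf).tendsto y).comp this
  have h2 : Tendsto (fun n => A * ε n ^ (1 / 4 : ℝ)) atTop (𝓝 0) := by
    have := ((Real.continuousAt_rpow_const 0 (1 / 4 : ℝ)
      (Or.inr (by norm_num))).tendsto.comp hε).const_mul A
    simpa using this
  have h3 : Tendsto (fun n => layer D f (logKernel 0) (y + ε n • z) -
      layer D f (logKernel (ε n)) (y + ε n • z)) atTop (𝓝 0) :=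
    squeeze_zero_norm (fun n => (hA _).2 (ε n) (hpos n)) h2
  simpa using h1.sub h3

theorem setIntegral_mul_layer_deltaKernel (hD : IsBoundedC2Domain D)
    (hf : Integrable f (arcLength D)) {ε : ℝ} (hε : ε ≠ 0) {u : Plane → ℝ} (hu : Continuous u) :
    AEStronglyMeasurable (fun y => (∫ x in D, u x * deltaKernel ε (x - y)) * f y) (arcLength D) ∧
    ∫ x in D, u x * layer D f (deltaKernel ε) x =
      ∫ y, (∫ x in D, u x * deltaKernel ε (x - y)) * f y ∂(arcLength D) := by
  have := hD.isFiniteMeasure_arcLength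
  have : IsFiniteMeasure (volume.restrict D) :=
    isFiniteMeasure_restrict.2 (hD.isBounded.measure_lt_top).ne
  obtain ⟨U, hU⟩ := hD.isCompact_closure.exists_bound_of_continuousOn hu.continuousOn
  have hint : Integrable (Function.uncurry fun x y => u x * deltaKernel ε (x - y) * f y)
      ((volume.restrict D).prod (arcLength D)) := by
    refine (hf.comp_snd (volume.restrict D)).bdd_mul
      (c := U * (1 / (Real.pi * ε ^ 2))) (f := fun z : Plane × Plane => u z.1 * deltaKernel ε (z.1 - z.2)) ?_ ?_
    · have := continuous_deltaKernel hε
      exact Continuous.aestronglyMeasurable (by fun_prop)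
    · have hae : ∀ᵐ x ∂(volume.restrict D), x ∈ D := ae_restrict_mem hD.isOpen.measurableSet
      filter_upwards [Measure.quasiMeasurePreserving_fst.ae hae] with z hz
      rw [norm_mul, Real.norm_of_nonneg (deltaKernel_nonneg _ _)]
      exact mul_le_mul (hU _ (subset_closure hz)) (deltaKernel_le hε _) (deltaKernel_nonneg _ _)
        ((norm_nonneg _).trans (hU _ (subset_closure hz)))
  constructor
  · refine hint.integral_prod_right.1.congr (Eventually.of_forall fun y => ?_)
    simp only [Function.uncurry_apply_pair]
    rw [integral_mul_const]
  · simp_rw [← integral_mul_const]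
    rw [← integral_integral_swap hint]
    refine integral_congr_ae (Eventually.of_forall fun x => ?_)
    simp only [layer, ← integral_const_mul, mul_assoc]

/-- Fubini puts the integral over `D` inside, where the half-mass limit applies at each boundary
point. The inner integral is at most `|U|`, so `|U| * |f|` dominates. The factor `1/2` replaces the
jump relation. -/
theorem tendsto_setIntegral_layer_mul_layer (hD : IsBoundedC2Domain D)
    (hf : MemLp f 2 (arcLength D)) {ε : ℕ → ℝ} (hpos : ∀ n, 0 < ε n) (hle : ∀ n, ε n ≤ 1)
    (hε : Tendsto ε atTop (𝓝 0)) :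
    Tendsto (fun n => ∫ x in D, layer D f (logKernel (ε n)) x * layer D f (deltaKernel (ε n)) x)
      atTop (𝓝 (∫ y, layer D f (logKernel 0) y / 2 * f y ∂(arcLength D))) := by
  have hf1 := hD.integrable_of_memLp hf
  obtain ⟨U, hU⟩ := hD.exists_abs_layer_logKernel_le hf
  have hcont : ∀ n, Continuous (layer D f (logKernel (ε n))) := fun n =>
    hD.continuous_layer_of_contDiff hf1 (contDiff_logKernel (hpos n).ne')
  have hswap := fun n => hD.setIntegral_mul_layer_deltaKernel hf1 (hpos n).ne' (hcont n)
  simp_rw [fun n => (hswap n).2]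
  refine tendsto_integral_of_dominated_convergence (fun y => |U| * |f y|) (fun n => (hswap n).1)
    (hf1.abs.const_mul _) (fun n => Eventually.of_forall fun y => ?_) ?_
  · rw [norm_mul]
    refine mul_le_mul_of_nonneg_right ?_ (norm_nonneg _)
    rw [setIntegral_mul_deltaKernel hD.isOpen.measurableSet _ (hpos n)]
    refine (norm_integral_le_of_norm_le (integrable_deltaKernel_one.const_mul |U|)
      (Eventually.of_forall fun z => ?_)).trans ?_
    · rw [norm_mul, Real.norm_of_nonneg (deltaKernel_nonneg 1 z)]
      refine mul_le_mul_of_nonneg_right ?_ (deltaKernel_nonneg 1 z)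
      by_cases hz : y + ε n • z ∈ D
      · rw [indicator_of_mem hz]
        exact (hU _ (hpos n) (hle n) _ (subset_closure hz)).trans (le_abs_self U)
      · rw [indicator_of_notMem hz]
        simp
    · rw [integral_const_mul, integral_deltaKernel_one, mul_one]
  · filter_upwards [ae_mem_frontier D] with y hy
    exact (hD.tendsto_setIntegral_mul_deltaKernel hy hpos hε hcont
      (fun n x hx => hU _ (hpos n) (hle n) x (subset_closure hx))
      (hD.tendsto_layer_logKernel hf hpos hε y)).mul_const _

theorem tendsto_integral_layer_mul_normalKernel (hD : IsBoundedC2Domain D)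
    (hf : MemLp f 2 (arcLength D)) {ε : ℕ → ℝ} (hpos : ∀ n, 0 < ε n) (hle : ∀ n, ε n ≤ 1)
    (hε : Tendsto ε atTop (𝓝 0)) :
    Tendsto (fun n => ∫ x, layer D f (logKernel (ε n)) x *
        (∫ y, normalKernel D (ε n) x y * f y ∂(arcLength D)) ∂(arcLength D)) atTop
      (𝓝 (∫ x, layer D f (logKernel 0) x *
        (∫ y, normalKernel D 0 x y * f y ∂(arcLength D)) ∂(arcLength D))) := by
  have := hD.isFiniteMeasure_arcLength
  have hf1 := hD.integrable_of_memLp hf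
  obtain ⟨U, hU⟩ := hD.exists_abs_layer_logKernel_le hf
  obtain ⟨B, hB⟩ := hD.exists_abs_normalKernel_le
  refine tendsto_integral_of_dominated_convergence
    (fun _ => |U| * ∫ y, B * |f y| ∂(arcLength D)) (fun n => ?_) (integrable_const _)
    (fun n => ?_) ?_
  · refine Integrable.aestronglyMeasurable (hD.integrable_arcLength_of_continuousOn ?_)
    refine (hD.continuous_layer_of_contDiff hf1
      (contDiff_logKernel (hpos n).ne')).continuousOn.mul ?_
    simp_rw [hD.integral_normalKernel_eq hf1 (hpos n).ne']
    refine continuousOn_finsetSum _ fun i _ => ?_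
    exact (hD.continuous_layer_of_contDiff hf1
      (contDiff_gradKernel (hpos n).ne' i)).continuousOn.mul (hD.continuousOn_inner_outwardNormal _)
  · filter_upwards [ae_mem_frontier D] with x hx
    rw [norm_mul]
    refine mul_le_mul ((hU _ (hpos n) (hle n) x (frontier_subset_closure hx)).trans
      (le_abs_self U)) ?_ (norm_nonneg _) (abs_nonneg _)
    refine norm_integral_le_of_norm_le (hf1.abs.const_mul B) ?_
    filter_upwards [ae_mem_frontier D] with y hy
    rw [norm_mul]
    exact mul_le_mul_of_nonneg_right (hB _ x hx y hy) (norm_nonneg _)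
  · filter_upwards [ae_mem_frontier D] with x hx
    have h1 := hD.tendsto_layer_logKernel hf hpos hε x 0
    simp only [smul_zero, add_zero] at h1
    exact h1.mul (hD.tendsto_integral_normalKernel hf1 hx hε)

theorem sub_ne_zero_of_mem_frontier (hD : IsBoundedC2Domain D) {x : Plane} (hx : x ∈ D) :
    ∀ y ∈ frontier D, x - y ∈ ({0}ᶜ : Set Plane) := by
  intro y hy h0
  rw [sub_eq_zero.1 h0] at hx
  exact (hD.isOpen.frontier_eq ▸ hy).2 hx

theorem contDiffOn_gradKernel_zero (i : Fin 2) {n : WithTop ℕ∞} :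
    ContDiffOn ℝ n (gradKernel 0 i) {0}ᶜ := fun x hx =>
  (contDiffAt_gradKernel (by have : x ≠ 0 := hx; positivity) i).contDiffWithinAt

theorem contDiffOn_logKernel_zero {n : WithTop ℕ∞} :
    ContDiffOn ℝ n (logKernel 0) {0}ᶜ := fun x hx =>
  (contDiffAt_logKernel (by have : x ≠ 0 := hx; positivity)).contDiffWithinAt

/-- The regularized gradient kernel is dominated by the singular one, which is bounded on `x - ∂D`
because `x` lies off the boundary. -/
theorem tendsto_layer_gradKernel (hD : IsBoundedC2Domain D) (hf : Integrable f (arcLength D))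
    {ε : ℕ → ℝ} (hpos : ∀ n, 0 < ε n) (hε : Tendsto ε atTop (𝓝 0)) {x : Plane} (hx : x ∈ D)
    (i : Fin 2) :
    Tendsto (fun n => layer D f (gradKernel (ε n) i) x) atTop
      (𝓝 (layer D f (gradKernel 0 i) x)) := by
  have hO := hD.sub_ne_zero_of_mem_frontier hx
  have hdom := hD.integrable_layer_kernel hf
    (contDiffOn_gradKernel_zero i (n := 0)).continuousOn hO
  refine tendsto_integral_of_dominated_convergence _ (fun n => ?_) hdom.norm (fun n => ?_) ?_
  · exact (hD.integrable_layer_kernel (O := univ) hf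
      (contDiff_gradKernel (hpos n).ne' i (n := 0)).continuous.continuousOn (by simp)).1
  · filter_upwards [ae_mem_frontier D] with y hy
    have hz : 0 < ‖x - y‖ := norm_pos_iff.2 (hO y hy)
    rw [norm_mul, norm_mul]
    refine mul_le_mul_of_nonneg_right ?_ (norm_nonneg _)
    have hpi := Real.pi_pos
    rw [gradKernel, gradKernel, norm_div, norm_div]
    refine div_le_div_of_nonneg_left (norm_nonneg _) ?_ ?_
    · rw [norm_pos_iff]; positivity
    · rw [Real.norm_of_nonneg (by positivity), Real.norm_of_nonneg (by positivity)]
      gcongr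
      exact (hpos n).le
  · filter_upwards [ae_mem_frontier D] with y hy
    have hz : 0 < ‖x - y‖ := norm_pos_iff.2 (hO y hy)
    refine Tendsto.mul_const _ ?_
    have hc : ContinuousAt (fun ε : ℝ => gradKernel ε i (x - y)) 0 := by
      unfold gradKernel
      refine continuousAt_const.div (by fun_prop) ?_
      have := Real.pi_pos
      positivity
    exact hc.tendsto.comp hε

/-- If the interior normal derivative `(-1/2 + K*) f` vanishes, so does the gradient of the
single-layer potential in the domain. -/
theorem layer_gradKernel_zero_eq_zero (hD : IsBoundedC2Domain D) (hf : MemLp f 2 (arcLength D))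
    (hK : ∀ᵐ x ∂(arcLength D), ∫ y, normalKernel D 0 x y * f y ∂(arcLength D) = 1 / 2 * f x) :
    ∀ x ∈ D, ∀ i, layer D f (gradKernel 0 i) x = 0 := by
  have hf1 := hD.integrable_of_memLp hf
  set ε : ℕ → ℝ := fun n => 1 / ((n : ℝ) + 1) with hεdef
  have hpos : ∀ n, 0 < ε n := fun n => Nat.one_div_pos_of_nat
  have hle : ∀ n, ε n ≤ 1 := fun n => by
    rw [hεdef]
    exact div_le_one_of_le₀ (by linarith [n.cast_nonneg (α := ℝ)]) (by positivity)
  have hε : Tendsto ε atTop (𝓝 0) := tendsto_one_div_add_atTop_nhds_zero_nat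
  set E : ℕ → Plane → ℝ := fun n x => ∑ i, layer D f (gradKernel (ε n) i) x ^ 2 with hE
  have hEc : ∀ n, Continuous (E n) := fun n => continuous_finsetSum _ fun i _ =>
    (hD.continuous_layer_of_contDiff hf1 (contDiff_gradKernel (hpos n).ne' i)).pow 2
  have hE0 : ∀ n x, 0 ≤ E n x := fun n x => Finset.sum_nonneg fun i _ => sq_nonneg _
  -- The eigenvalue `1/2` makes the limits of the boundary term and of the Laplacian term equal, so
  -- the Dirichlet energy tends to zero.
  have hlim : Tendsto (fun n => ∫ x in D, E n x) atTop (𝓝 0) := by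
    have h1 := hD.tendsto_integral_layer_mul_normalKernel hf hpos hle hε
    have h2 := hD.tendsto_setIntegral_layer_mul_layer hf hpos hle hε
    have h3 : ∫ x, layer D f (logKernel 0) x *
        (∫ y, normalKernel D 0 x y * f y ∂(arcLength D)) ∂(arcLength D) =
        ∫ y, layer D f (logKernel 0) y / 2 * f y ∂(arcLength D) := by
      refine integral_congr_ae ?_
      filter_upwards [hK] with x hx
      rw [hx]
      ring
    rw [h3] at h1
    have h4 := h1.sub h2
    rw [sub_self] at h4
    refine h4.congr fun n => ?_
    rw [← hD.regularized_green_identity hf1 (hpos n).ne', add_sub_cancel_right]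
  set E0 : Plane → ℝ := fun x => ∑ i, layer D f (gradKernel 0 i) x ^ 2 with hE0def
  have hElim : ∀ x ∈ D, Tendsto (fun n => E n x) atTop (𝓝 (E0 x)) := fun x hx =>
    tendsto_finsetSum _ fun i _ => (hD.tendsto_layer_gradKernel hf1 hpos hε hx i).pow 2
  have hE0c : ContinuousOn E0 D := by
    intro x hx
    refine ContinuousAt.continuousWithinAt ?_
    refine tendsto_finsetSum _ fun i _ => ?_
    exact ((hD.differentiableAt_layer hf1 isOpen_compl_singleton (contDiffOn_gradKernel_zero i)
      (hD.sub_ne_zero_of_mem_frontier hx)).continuousAt.pow 2)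
  -- Fatou's lemma needs only pointwise convergence inside `D`, with no control of the gradient up
  -- to the boundary.
  have hl : ∫⁻ x in D, ENNReal.ofReal (E0 x) = 0 := by
    refine le_antisymm ?_ bot_le
    have hfatou := lintegral_liminf_le (u := atTop) (μ := volume.restrict D)
      (f := fun n x => ENNReal.ofReal (E n x)) fun n => (hEc n).measurable.ennreal_ofReal
    have hrhs : liminf (fun n => ∫⁻ x in D, ENNReal.ofReal (E n x)) atTop = 0 := by
      refine Tendsto.liminf_eq ?_
      have h5 := ENNReal.tendsto_ofReal hlim
      rw [ENNReal.ofReal_zero] at h5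
      refine h5.congr fun n => ?_
      rw [ofReal_integral_eq_lintegral_ofReal (hD.integrableOn_of_continuous (hEc n))
        (Eventually.of_forall (hE0 n))]
    rw [hrhs] at hfatou
    refine le_trans (le_of_eq ?_) hfatou
    refine setLIntegral_congr_fun hD.isOpen.measurableSet fun x hx => ?_
    exact ((ENNReal.tendsto_ofReal (hElim x hx)).liminf_eq).symm
  have hae : E0 =ᵐ[volume.restrict D] 0 := by
    have hm : AEMeasurable (fun x => ENNReal.ofReal (E0 x)) (volume.restrict D) :=
      (hE0c.aemeasurable hD.isOpen.measurableSet).ennreal_ofReal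
    filter_upwards [(lintegral_eq_zero_iff' hm).1 hl] with x hx
    exact le_antisymm (ENNReal.ofReal_eq_zero.1 hx) (Finset.sum_nonneg fun i _ => sq_nonneg _)
  -- Continuity on the open set `D` upgrades almost everywhere to everywhere.
  have heq : EqOn E0 0 D :=
    Measure.eqOn_open_of_ae_eq hae hD.isOpen hE0c continuousOn_const
  intro x hx i
  have h0 : ∑ i, layer D f (gradKernel 0 i) x ^ 2 = 0 := heq hx
  have := (Finset.sum_eq_zero_iff_of_nonneg fun i _ => sq_nonneg _).1 h0 i (Finset.mem_univ i)
  exact pow_eq_zero_iff two_ne_zero |>.1 this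

theorem exists_layer_logKernel_zero_eq (hD : IsBoundedC2Domain D) (hf : MemLp f 2 (arcLength D))
    (hK : ∀ᵐ x ∂(arcLength D), ∫ y, normalKernel D 0 x y * f y ∂(arcLength D) = 1 / 2 * f x) :
    ∃ c : ℝ, ∀ x ∈ D, layer D f (logKernel 0) x = c := by
  have hf1 := hD.integrable_of_memLp hf
  refine hD.isOpen.exists_is_const_of_fderiv_eq_zero hD.isConnected.isPreconnected
    (fun x hx => (hD.differentiableAt_layer hf1 isOpen_compl_singleton contDiffOn_logKernel_zero
      (hD.sub_ne_zero_of_mem_frontier hx)).differentiableWithinAt) fun x hx => ?_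
  have hO := hD.sub_ne_zero_of_mem_frontier hx
  have hb : ∀ i, fderiv ℝ (layer D f (logKernel 0)) x (EuclideanSpace.single i 1) = 0 := by
    intro i
    rw [hD.fderiv_layer hf1 isOpen_compl_singleton contDiffOn_logKernel_zero hO]
    refine Eq.trans (integral_congr_ae ?_) (hD.layer_gradKernel_zero_eq_zero hf hK x hx i)
    filter_upwards [ae_mem_frontier D] with y hy
    have hz : 0 < ‖x - y‖ := norm_pos_iff.2 (hO y hy)
    rw [fderiv_logKernel (by positivity)]
  refine ContinuousLinearMap.coe_injective ?_
  refine (EuclideanSpace.basisFun (Fin 2) ℝ).toBasis.ext fun i => ?_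
  simpa using hb i

end IsBoundedC2Domain

/-! ### Reduction of complex densities to real ones. -/

theorem mainTheorem3 (D : Set Plane) (hD : IsBoundedC2Domain D) (ψ₀ : Plane → ℂ)
    (hψ₀ : IsNPEigenfunction D (1 / 2) ψ₀) :
    ∃ C : ℂ, ∀ x ∈ D, singleLayer D ψ₀ x = C := by
  obtain ⟨hL, -, hK⟩ := hψ₀
  have := hD.isFiniteMeasure_arcLength
  have hψi : Integrable ψ₀ (arcLength D) := hL.integrable (by norm_num)
  obtain ⟨B, hB⟩ := hD.exists_abs_normalKernel_le
  have hNP : ∀ x ∈ frontier D,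
      Integrable (fun y => (normalKernel D 0 x y : ℂ) * ψ₀ y) (arcLength D) ∧
      neumannPoincare D ψ₀ x = ∫ y, (normalKernel D 0 x y : ℂ) * ψ₀ y ∂(arcLength D) := by
    intro x hx
    constructor
    · refine hψi.bdd_mul (c := B) (Measurable.aestronglyMeasurable ?_) ?_
      · refine Complex.measurable_ofReal.comp ?_
        unfold normalKernel
        fun_prop
      · filter_upwards [IsBoundedC2Domain.ae_mem_frontier D] with y hy
        rw [Complex.norm_real]
        exact hB 0 x hx y hy
    · rw [neumannPoincare, ← integral_const_mul]
      refine integral_congr_ae (Eventually.of_forall fun y => ?_)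
      simp only [normalKernel]
      push_cast
      rw [← mul_assoc]
      congr 1
      rw [zero_pow two_ne_zero, add_zero, one_div, inv_mul_eq_div, div_div, mul_comm (2 * _)]
  have hre : MemLp (fun y => (ψ₀ y).re) 2 (arcLength D) := hL.re
  have him : MemLp (fun y => (ψ₀ y).im) 2 (arcLength D) := hL.im
  obtain ⟨a, ha⟩ := hD.exists_layer_logKernel_zero_eq hre (by
    filter_upwards [hK, IsBoundedC2Domain.ae_mem_frontier D] with x hx hxf
    rw [(hNP x hxf).2] at hx
    have h1 := congrArg Complex.re hx
    have h2 := Complex.reCLM.integral_comp_comm (hNP x hxf).1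
    simp only [Complex.reCLM_apply, Complex.re_ofReal_mul] at h2
    rw [h2, h1]
    simp)
  obtain ⟨b, hb⟩ := hD.exists_layer_logKernel_zero_eq him (by
    filter_upwards [hK, IsBoundedC2Domain.ae_mem_frontier D] with x hx hxf
    rw [(hNP x hxf).2] at hx
    have h1 := congrArg Complex.im hx
    have h2 := Complex.imCLM.integral_comp_comm (hNP x hxf).1
    simp only [Complex.imCLM_apply, Complex.im_ofReal_mul] at h2
    rw [h2, h1]
    simp)
  refine ⟨⟨a, b⟩, fun x hx => ?_⟩
  -- Integrability is what allows real and imaginary parts to be taken inside the integral.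
  have hint : Integrable (fun y => (fundamentalSolution (x - y) : ℂ) * ψ₀ y) (arcLength D) := by
    obtain ⟨_, -, hA⟩ := hD.exists_abs_layer_logKernel_sub_le hre
    obtain ⟨_, -, hA'⟩ := hD.exists_abs_layer_logKernel_sub_le him
    rw [← logKernel_zero]
    have h1 := ((hA x).1.ofReal (𝕜 := ℂ)).add (((hA' x).1.ofReal (𝕜 := ℂ)).mul_const Complex.I)
    refine h1.congr (Eventually.of_forall fun y => ?_)
    apply Complex.ext <;> simp
  have h1 := Complex.reCLM.integral_comp_comm hint
  have h2 := Complex.imCLM.integral_comp_comm hint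
  simp only [Complex.reCLM_apply, Complex.re_ofReal_mul] at h1
  simp only [Complex.imCLM_apply, Complex.im_ofReal_mul] at h2
  rw [← logKernel_zero] at h1 h2
  apply Complex.ext
  · rw [singleLayer, ← logKernel_zero, ← h1]
    exact ha x hx
  · rw [singleLayer, ← logKernel_zero, ← h2]
    exact hb x hx
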